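/- **Setting.** An exchange market has $n$ agents and $m\ge 1$ goods. Agent $i$ has an endowment $w_{ij}\ge 0$ of good $j$, with $\sum_i w_{ij}=1$ for every $j$, and a utility function $u_i$ that is non-decreasing on $\mathbb R^m_{\ge 0}$. A demand of agent $i$ at prices $p\ge 0$ is a bundle $x_i\ge 0$ with $p^Tx_i\le p^Tw_i$ that maximizes $u_i$ among all such bundles; at strictly positive prices every agent is assumed to have exactly one demand. $(x,p)$ is an equilibrium if every $x_i$ is a demand at $p$ and $\sum_i x_{ij}=\sum_i w_{ij}$ for all $j$; it is a $\rho$-approximate equilibrium if every $x_i$ is a demand at $p$ and $\sum_i x_{ij}\le \rho\sum_i w_{ij}$ for all $j$. The surplus of good $j$ at $p>0$ is $s_j(p)=p_j(x_j-1)$, where $x_j$ is the aggregate demand for $j$. The market has the weak gross substitutes property (WGS): raising one price does not decrease the aggregate demand for any other good. A demand oracle $\tilde O$ returns, for rational $p>0$ and rational $\mu>0$, a rational vector $\tilde O(p,\mu)$ with $|\tilde O(p,\mu)_j-s_j(p)|\le\mu$ for all $j$. **Assumption 1.** There is an equilibrium $(x^*,p^*)$ with $1\le p^*_j\le 2^{D_1}$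 for all $j$. **Assumption 2.** At all $p\in[1,2^{D_1}]^m$ the partial derivatives $\partial s_i/\partial p_j$ exist and satisfy $|\partial s_i/\partial p_j|<2^{D_2}$. Here $D_1,D_2\in\mathbb N$. **Algorithm (Alg-WGS)** with input $m,D_1,D_2$, rational $\varepsilon>0$, access to $\tilde O$, and a constant $R_1\in\mathbb N$. Put $\mu=\varepsilon/(R_1m^7)$, $\Delta=2^{D_1+D_2}m/\mu$, $\varepsilon'=\varepsilon/(2\sqrt m)$, $\mathcal P=\{a/b: a,b\in\mathbb Z^+,\ b<a\le\Delta\}$, $p_0=(1,\dots,1)$. In round $t=1,2,\dots$: query $\tilde s=\tilde O(p_{t-1},\mu)$ and sort $\tilde s_{i_1}\ge\dots\ge\tilde s_{i_m}$; let $k\ge 1$ be smallest with $k=m$ or $\tilde s_{i_{k+1}}\le\mu$ or $\tilde s_{i_k}>(1+\frac1m)\tilde s_{i_{k+1}}$, and $G_1=\{i_1,\dots,i_k\}$. For $x\ge 1$ let $p^x$ arise from $p_{t-1}$ by multiplying the prices of the goods in $G_1$ by $x$, and say that $x$ passes if $\tilde s'=\tilde O(p^x,\mu)$ satisfies $\min_{i\in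 G_1}\tilde s'_i\ge\max(\{\tilde s'_j: j\notin G_1\}\cup\{\mu\})$. By binary search find $x\in\mathcal P$ that passes while the next larger element of $\mathcal P$, if any, does not (the search starts from $x=1$ as lower end, which is kept if every tested element of $\mathcal P$ fails); put $p_t=p^x$. Stop and return $p_t$ as soon as $\|\tilde O(p_t,\mu)\|_2^2<\varepsilon'^2$. The binary search runs along the Stern–Brocot order of the fractions in $\mathcal P$: exponential search and bisection move the two ends of the current bracket in turn. **Theorem.** For every sufficiently large constant $R_1$ there is a constant $C$ such that the following holds for all $n$, all $m\ge1$, every exchange market with unique demands and the WGS property that satisfies Assumptions 1 and 2, every rational $\varepsilon>0$ and every oracle $\tilde O$ as above. Write $\ell=\max\{1,\log(1/\varepsilon)\}$ and $$B=\bigl(D_1m^7\log m+m^3\ell\bigr)\bigl(D_1+D_2+\log m+\ell\bigr).$$ Alg-WGS stops after at most $C\,(D_1m^7\log m+m^3\ell)$ rounds and returns a price vector $p$ for which there is $x$ such that $(x,p)$ is a $(1+\varepsilon)$-approximate equilibrium. It makes at most $C\,B$ oracle queries and its running time (arithmetic operations, comparisons and copying of numbers, each at unit cost, plus one step per query) is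 at most $C\,m^2B$. All prices it publishes are positive rationals whose numerators and denominators have at most $C\,B$ bits. In particular, the running time is polynomial in $m,D_1,D_2$ and $\log(1/\varepsilon)$. -/

import Mathlib

namespace WGS

/-! ### Exchange markets -/

/-- An exchange market with `n` agents and `m` goods: nonnegative endowments with total endowment
one of every good, and utility functions that are non-decreasing on the nonnegative orthant. -/
structure ExchangeMarket (n m : ℕ) where
  endow : Fin n → Fin m → ℝ
  endow_nonneg : ∀ i j, 0 ≤ endow i j
  endow_total : ∀ j, ∑ i, endow i j = 1
  utility : Fin n → (Fin m → ℝ) → ℝ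
  utility_mono : ∀ i, MonotoneOn (utility i) {x | 0 ≤ x}

namespace ExchangeMarket

variable {n m : ℕ} (M : ExchangeMarket n m)

/-- The bundles that agent `i` can afford at prices `p` by selling the endowment. -/
def budgetSet (i : Fin n) (p : Fin m → ℝ) : Set (Fin m → ℝ) :=
  {y | 0 ≤ y ∧ ∑ j, p j * y j ≤ ∑ j, p j * M.endow i j}

/-- `x` is a demand of agent `i` at prices `p`: a utility-maximizing affordable bundle. -/
def IsDemand (i : Fin n) (p x : Fin m → ℝ) : Prop :=
  x ∈ M.budgetSet i p ∧ ∀ y ∈ M.budgetSet i p, M.utility i y ≤ M.utility i x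

/-- `(x, p)` is an exact market equilibrium. -/
def IsEquilibrium (x : Fin n → Fin m → ℝ) (p : Fin m → ℝ) : Prop :=
  0 ≤ p ∧ (∀ i, M.IsDemand i p (x i)) ∧ ∀ j, ∑ i, x i j = ∑ i, M.endow i j

/-- `(x, p)` is a (strong) `ρ`-approximate market equilibrium: every agent gets an exact demand and
only market clearing is relaxed. -/
def IsApproxEquilibrium (ρ : ℝ) (x : Fin n → Fin m → ℝ) (p : Fin m → ℝ) : Prop :=
  0 ≤ p ∧ (∀ i, M.IsDemand i p (x i)) ∧ ∀ j, ∑ i, x i j ≤ ρ * ∑ i, M.endow i j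

/-- At all positive prices every agent has exactly one demand bundle. -/
def UniqueDemands : Prop :=
  ∀ p : Fin m → ℝ, (∀ j, 0 < p j) → ∀ i, ∃! x, M.IsDemand i p x

/-- The demand bundle of agent `i` at prices `p` (meaningful where it exists and is unique). -/
noncomputable def demand (i : Fin n) (p : Fin m → ℝ) : Fin m → ℝ :=
  Classical.epsilon (M.IsDemand i p)

/-- The aggregate demand for good `j`. -/
noncomputable def aggDemand (p : Fin m → ℝ) (j : Fin m) : ℝ := ∑ i, M.demand i p j

/-- The surplus `s_j = p_j z_j`, with `z_j` the excess demand for good `j`. -/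
noncomputable def surplus (p : Fin m → ℝ) (j : Fin m) : ℝ := p j * (M.aggDemand p j - 1)

/-- Weak gross substitutes: increasing one (positive) price does not decrease the aggregate demand
for any other good. -/
def WeakGrossSubstitutes : Prop :=
  ∀ p : Fin m → ℝ, (∀ j, 0 < p j) → ∀ (k : Fin m) (q : ℝ), p k ≤ q →
    ∀ j, j ≠ k → M.aggDemand p j ≤ M.aggDemand (Function.update p k q) j

/-- Bounded prices: some market equilibrium has all prices in `[1, 2 ^ D₁]`. -/
def BoundedPrice (D₁ : ℕ) : Prop :=
  ∃ x p, M.IsEquilibrium x p ∧ ∀ j, 1 ≤ p j ∧ p j ≤ 2 ^ D₁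

/-- Continuity: on the box `[1, 2 ^ D₁] ^ m` all partial derivatives `∂ s_i / ∂ p_j` exist and have
absolute value less than `2 ^ D₂`. -/
def BoundedDerivatives (D₁ D₂ : ℕ) : Prop :=
  ∀ p : Fin m → ℝ, (∀ j, 1 ≤ p j ∧ p j ≤ 2 ^ D₁) → ∀ i j, ∃ d : ℝ,
    HasDerivAt (fun t => M.surplus (Function.update p j t) i) d (p j) ∧ |d| < 2 ^ D₂

/-- `O` is an approximate aggregate demand oracle for the market: at every positive rational price
vector `p` and rational precision `μ > 0` it returns the surplus vector up to `μ` in every entry. -/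
def IsApproxOracle (O : (Fin m → ℚ) × ℚ → (Fin m → ℚ)) : Prop :=
  ∀ (p : Fin m → ℚ) (μ : ℚ), (∀ j, 0 < p j) → 0 < μ →
    ∀ j, |(O (p, μ) j : ℝ) - M.surplus (fun k => (p k : ℝ)) j| ≤ (μ : ℝ)

end ExchangeMarket

/-! ### Programs with oracle access and their cost -/

/-- Programs that put questions of type `Q` to an oracle with answers of type `A`. The oracle can be
reached through `query` only; `charge c` pays for `c` elementary operations. -/
inductive OracleProg (Q A α : Type) : Type
  | done (a : α) : OracleProg Q A α
  | charge (c : ℕ) (k : OracleProg Q A α) : OracleProg Q A α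
  | query (q : Q) (k : A → OracleProg Q A α) : OracleProg Q A α

namespace OracleProg

variable {Q A α β : Type}

/-- Sequential composition. -/
def andThen : OracleProg Q A α → (α → OracleProg Q A β) → OracleProg Q A β
  | done a, f => f a
  | charge c k, f => charge c (andThen k f)
  | query q k, f => query q (fun a => andThen (k a) f)

instance : Monad (OracleProg Q A) where
  pure := done
  bind := andThen

/-- The program that pays for `c` elementary operations. -/
def pay (c : ℕ) : OracleProg Q A Unit := charge c (done ())

/-- The program that asks the single question `q`. -/
def ask (q : Q) : OracleProg Q A A := query q done

/-- The result of a run against the oracle `O`. -/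
def result (O : Q → A) : OracleProg Q A α → α
  | done a => a
  | charge _ k => result O k
  | query q k => result O (k (O q))

/-- The list of all questions asked in a run against `O`. -/
def queries (O : Q → A) : OracleProg Q A α → List Q
  | done _ => []
  | charge _ k => queries O k
  | query q k => q :: queries O (k (O q))

/-- The running time of a run against `O`: all elementary operations, and one step per query. -/
def time (O : Q → A) : OracleProg Q A α → ℕ
  | done _ => 0
  | charge c k => c + time O k
  | query q k => 1 + time O (k (O q))

end OracleProg

open OracleProg

/-! ### Binary search over bounded fractions

The elementary operations that are paid for are arithmetic operations and comparisons on rational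
numbers and integers, and copying a number. -/

section Search

variable {Q A : Type}

/-- Bisection for an index `j ∈ [lo, hi)` such that the test holds at `j` and fails at `j + 1`, where
it is taken to hold at `lo` and to fail at `hi`. The first argument bounds the recursion depth; depth
`hi` suffices. -/
def bisect (test : ℕ → OracleProg Q A Bool) : ℕ → ℕ → ℕ → OracleProg Q A ℕ
  | 0, lo, _ => pure lo
  | f + 1, lo, hi => do
    pay 4
    if hi ≤ lo + 1 then pure lo
    else
      let mid := (lo + hi) / 2
      let b ← test mid
      if b then bisect test f mid hi else bisect test f lo mid

/-- Exponential search: double `e` as long as `e ≤ J` and the test holds at `e`, then bisect. Here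
the test is taken to hold at `e / 2`, and to fail beyond `J`. -/
def expSearch (test : ℕ → OracleProg Q A Bool) (J : ℕ) : ℕ → ℕ → OracleProg Q A ℕ
  | 0, e => pure (e / 2)
  | f + 1, e => do
    pay 4
    if J < e then bisect test (J + 1) (e / 2) (J + 1)
    else
      let b ← test e
      if b then expSearch test J f (2 * e) else bisect test e (e / 2) e

/-- An index `j ≤ J` such that the test holds at `j` (or `j = 0`) and fails at `j + 1`
(or `j = J`). -/
def gallop (test : ℕ → OracleProg Q A Bool) (J : ℕ) : OracleProg Q A ℕ :=
  expSearch test J (J + 1) 1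

/-- Binary search in `𝒫 = {a / b : a > b ≥ 1, a ≤ N}` for a fraction at which `test` (applied to
numerator and denominator) holds while it fails at the next larger element of `𝒫`, if any.
The bracket is `lo = a / b` (test holds, or `lo = 1`) and `hi = c / d` (test fails, or `hi = 1 / 0`),
always with `c b - a d = 1`, so that `lo` and `hi` are neighbours in `𝒫` as soon as `a + c > N`.
In turn `lo` is moved up as far as possible through `(a + j c) / (b + j d)`, and `hi` down
through `(c + j a) / (d + j b)`. The first argument bounds the recursion depth; `N` suffices. -/
def fracSearch (test : ℕ → ℕ → OracleProg Q A Bool) (N : ℕ) :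
    ℕ → ℕ → ℕ → ℕ → ℕ → OracleProg Q A (ℕ × ℕ)
  | 0, a, b, _, _ => pure (a, b)
  | f + 1, a, b, c, d => do
    pay 2
    if N < a + c then pure (a, b)
    else
      pay 2
      let j ← gallop (fun j => do pay 4; test (a + j * c) (b + j * d)) ((N - a) / c)
      pay 6
      let a' := a + j * c
      let b' := b + j * d
      if N < a' + c then pure (a', b')
      else
        pay 2
        let l ← gallop
          (fun l => do
            pay 5
            let t ← test (c + l * a') (d + l * b')
            pure (!t))
          ((N - c) / a')
        pay 4
        fracSearch test N f a' b' (c + l * a') (d + l * b')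

end Search

/-! ### The algorithm -/

section Algorithm

variable {m : ℕ}

/-- Multiply the prices of the goods in `S` by `x`. -/
def updatePrices (p : Fin m → ℚ) (x : ℚ) (S : Finset (Fin m)) : Fin m → ℚ :=
  fun i => if i ∈ S then x * p i else p i

/-- From a list `i₁, i₂, …` of goods sorted by decreasing surplus, keep `i₁, …, i_k` for the smallest
`k ≥ 1` such that `s_{i_{k+1}} ≤ μ` or `s_{i_k} > (1 + 1 / m) s_{i_{k+1}}` (all, if there is none). -/
def gapPrefix (s : Fin m → ℚ) (μ : ℚ) : List (Fin m) → List (Fin m)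
  | [] => []
  | [i] => [i]
  | i :: j :: l =>
    if s j ≤ μ ∨ (1 + 1 / (m : ℚ)) * s j < s i then [i] else i :: gapPrefix s μ (j :: l)

/-- The set `G₁` for the surplus vector `s`. -/
def topGoods (s : Fin m → ℚ) (μ : ℚ) : Finset (Fin m) :=
  (gapPrefix s μ ((List.finRange m).insertionSort (fun i j => s j ≤ s i))).toFinset

/-- The condition `min {s_i : i ∈ G₁} ≥ max ({s_j : j ∉ G₁} ∪ {μ})`. -/
def SearchCond (s : Fin m → ℚ) (μ : ℚ) (G₁ : Finset (Fin m)) : Prop :=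
  ∀ i ∈ G₁, μ ≤ s i ∧ ∀ j, j ∉ G₁ → s j ≤ s i

instance (s : Fin m → ℚ) (μ : ℚ) (G₁ : Finset (Fin m)) : Decidable (SearchCond s μ G₁) := by
  unfold SearchCond; infer_instance

/-- Programs that query an approximate surplus oracle for `m` goods. -/
abbrev MarketProg (m : ℕ) (α : Type) : Type := OracleProg ((Fin m → ℚ) × ℚ) (Fin m → ℚ) α

/-- One round: from `p_{t-1}` compute `p_t`, with oracle precision `μ` and with numerators and
denominators of the price factor at most `N`. (If no factor in `𝒫` passes the test,
the prices stay as they are.) Costs: `m ^ 2` for sorting by insertion, `4 m` for the gap,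
`1 + m` for the division and the price update, `2 m` for minimum and maximum. -/
def round (μ : ℚ) (N : ℕ) (p : Fin m → ℚ) : MarketProg m (Fin m → ℚ) := do
  let s ← ask (p, μ)
  pay (m ^ 2 + 4 * m)
  let G₁ := topGoods s μ
  let (a, b) ← fracSearch
    (fun a b => do
      pay (1 + m)
      let s' ← ask (updatePrices p ((a : ℚ) / (b : ℚ)) G₁, μ)
      pay (2 * m)
      pure (decide (SearchCond s' μ G₁)))
    N N 1 1 1 0
  pay (1 + m)
  pure (updatePrices p ((a : ℚ) / (b : ℚ)) G₁)

/-- Repeat rounds until the squared norm of the approximate surplus is less than `δ`; give up with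
`none` after `T` rounds. -/
def roundsUntil (μ : ℚ) (N : ℕ) (δ : ℚ) : ℕ → (Fin m → ℚ) → MarketProg m (Option (Fin m → ℚ))
  | 0, _ => pure none
  | T + 1, p => do
    let p' ← round μ N p
    let s ← ask (p', μ)
    pay (2 * m + 1)
    if ∑ i, s i ^ 2 < δ then pure (some p') else roundsUntil μ N δ T p'

/-- The oracle precision `μ = ε / (R₁ m ^ 7)`. -/
def precision (R₁ m : ℕ) (ε : ℚ) : ℚ := ε / (R₁ * m ^ 7)

/-- The bound `Δ = 2 ^ (D₁ + D₂ + log₂ m) / μ` on numerators and denominators. -/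
def fracBound (R₁ m D₁ D₂ : ℕ) (ε : ℚ) : ℚ := 1 / precision R₁ m ε * (2 ^ (D₁ + D₂) * m)

/-- The algorithm, cut off after `T` rounds, started at prices `(1, …, 1)`. It stops as soon as the
squared norm of the approximate surplus is less than `ε' ^ 2`, where `ε' = ε / (2 √m)`.
It pays `D₁ + D₂ + m + 20` for computing the parameters and writing down the initial prices. -/
def algWGS (R₁ m D₁ D₂ : ℕ) (ε : ℚ) (T : ℕ) : MarketProg m (Option (Fin m → ℚ)) := do
  pay (D₁ + D₂ + m + 20)
  roundsUntil (precision R₁ m ε) ⌊fracBound R₁ m D₁ D₂ ε⌋₊ (ε ^ 2 / (4 * m)) T (fun _ => 1)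

end Algorithm

/-! ### The bounds -/

/-- `log (1 / ε)`, read as `1` where it is smaller than that. -/
noncomputable def logInv (ε : ℚ) : ℝ := max 1 (Real.log (1 / (ε : ℝ)))

/-- `D₁ m ^ 7 log m + m ^ 3 log (1 / ε)`. -/
noncomputable def roundBound (m D₁ : ℕ) (ε : ℚ) : ℝ :=
  D₁ * (m : ℝ) ^ 7 * Real.log m + (m : ℝ) ^ 3 * logInv ε

/-- `(D₁ m ^ 7 log m + m ^ 3 log (1 / ε)) (D₁ + D₂ + log m + log (1 / ε))`. -/
noncomputable def queryBound (m D₁ D₂ : ℕ) (ε : ℚ) : ℝ :=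
  roundBound m D₁ ε * (D₁ + D₂ + Real.log m + logInv ε)

end WGS

/-! Every price vector reached is `Admissible`: no price is below one, and a good priced above one
has nonnegative surplus. Let p be such a vector and r ≥ 1 equilibrium prices. Capping p at r changes
no surplus. By WGS no surplus goes up, because a good above its cap ends with at most its
equilibrium surplus zero; by Walras' law both surplus vectors sum to zero, so equality holds
everywhere (`surplus_min_eq`). Hence the derivative bound, assumed only on the box, still controls
prices that have left the box, and a good priced at or above r has no positive surplus.

Progress is measured by Φ = ∑ max(s_j, 0)². When the prices of G₁ are multiplied by x, surpluses in
G₁ grow at most by the factor x (WGS and homogeneity), the others do not fall, and G₁ stays on top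
up to 2μ. Surplus thus moves from large entries to small ones, which lowers Φ up to a loss governed
by x (`sum_posPart_sq_le`). The next larger fraction fails the test and is so close that capped
surpluses change by at most 4μ. So at x either a surplus in G₁ has almost vanished or the gap below
G₁ has almost closed. With A the maximal surplus, some entry has then moved by A/(20m), and Φ falls
to at most (1 - 1/(800m³)) x⁴ Φ (`round_progress`).

The factor x⁴ is charged to the prices. While a sizeable surplus remains, some good of G₁ is still
at or below r after scaling, so ∑ log min(p_j, r_j), which lies between 0 and m D₁ log 2, grows by
at least log x. Therefore `potential` drops by 1/(800m³) in every round that does not stop; it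
starts at most at 3 log m and is bounded below as long as a surplus exceeds ε/(4m²). This bounds the
rounds.

For the cost, `fracSearch_spec` amortizes galloping steps against the growth of the numerator of the
upper end, so a round needs O(log N) tests. Prices are products of one bounded fraction per round,
which bounds their bit lengths. -/

namespace WGS

/-! ### Demands and surpluses in markets with unique demands -/

namespace ExchangeMarket

variable {n m : ℕ} {M : ExchangeMarket n m}

theorem isDemand_demand (hU : M.UniqueDemands) {p : Fin m → ℝ} (hp : ∀ j, 0 < p j) (i : Fin n) :
    M.IsDemand i p (M.demand i p) :=
  Classical.epsilon_spec (hU p hp i).exists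

theorem IsDemand.eq_demand (hU : M.UniqueDemands) {p x : Fin m → ℝ} (hp : ∀ j, 0 < p j)
    {i : Fin n} (hx : M.IsDemand i p x) : x = M.demand i p :=
  (hU p hp i).unique hx (isDemand_demand hU hp i)

/-- A unique demand exhausts the budget. -/
theorem sum_mul_demand (hm : 1 ≤ m) (hU : M.UniqueDemands) {p : Fin m → ℝ} (hp : ∀ j, 0 < p j)
    (i : Fin n) : ∑ j, p j * M.demand i p j = ∑ j, p j * M.endow i j := by
  obtain ⟨⟨h0, hb⟩, hmax⟩ := isDemand_demand hU hp i
  refine le_antisymm hb (not_lt.1 fun hlt => ?_)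
  -- Unspent money buys more of one good. By monotonicity of the utility the larger bundle is
  -- optimal too, against uniqueness.
  let k : Fin m := ⟨0, hm⟩
  set δ := (∑ j, p j * M.endow i j - ∑ j, p j * M.demand i p j) / p k with hδ
  have hδ0 : 0 < δ := div_pos (sub_pos.2 hlt) (hp k)
  have hle : M.demand i p ≤ M.demand i p + Pi.single k δ :=
    le_add_of_nonneg_right (Pi.single_nonneg.2 hδ0.le)
  have hy0 : 0 ≤ M.demand i p + Pi.single k δ := h0.trans hle
  have hy : M.demand i p + Pi.single k δ ∈ M.budgetSet i p := by
    refine ⟨hy0, le_of_eq ?_⟩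
    have hs : ∑ j, p j * (Pi.single k δ : Fin m → ℝ) j = p k * δ := by
      rw [Finset.sum_eq_single k (fun j _ hj => by simp [hj]) (by simp), Pi.single_eq_same]
    simp only [Pi.add_apply, mul_add, Finset.sum_add_distrib]
    rw [hs, hδ, mul_div_cancel₀ _ (hp k).ne']
    ring
  have hd : M.IsDemand i p (M.demand i p + Pi.single k δ) :=
    ⟨hy, fun y hy' => (hmax y hy').trans (M.utility_mono i h0 hy0 hle)⟩
  have := congrFun (hd.eq_demand hU hp) k
  simp at this
  exact hδ0.ne' this

/-- Walras' law. -/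
theorem sum_surplus (hm : 1 ≤ m) (hU : M.UniqueDemands) {p : Fin m → ℝ} (hp : ∀ j, 0 < p j) :
    ∑ j, M.surplus p j = 0 := by
  have h1 : ∑ j, p j * M.aggDemand p j = ∑ j, p j := by
    simp only [aggDemand, Finset.mul_sum]
    rw [Finset.sum_comm, Finset.sum_congr rfl fun i _ => sum_mul_demand hm hU hp i,
      Finset.sum_comm]
    refine Finset.sum_congr rfl fun j _ => ?_
    rw [← Finset.mul_sum, M.endow_total, mul_one]
  simp only [surplus, mul_sub, mul_one, Finset.sum_sub_distrib, h1, sub_self]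

theorem aggDemand_nonneg (hU : M.UniqueDemands) {p : Fin m → ℝ} (hp : ∀ j, 0 < p j) (j : Fin m) :
    0 ≤ M.aggDemand p j :=
  Finset.sum_nonneg fun i _ => (isDemand_demand hU hp i).1.1 j

/-- Demands are homogeneous of degree zero in the prices. -/
theorem aggDemand_smul (p : Fin m → ℝ) {c : ℝ} (hc : 0 < c) :
    M.aggDemand (fun j => c * p j) = M.aggDemand p := by
  have hB : ∀ i, M.budgetSet i (fun j => c * p j) = M.budgetSet i p := fun i => by
    ext y
    simp only [budgetSet, Set.mem_ofPred_eq, mul_assoc, ← Finset.mul_sum, mul_le_mul_iff_right₀ hc]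
  have hD : ∀ i, M.IsDemand i (fun j => c * p j) = M.IsDemand i p := fun i => by
    ext x
    simp only [IsDemand, hB]
  ext j
  simp only [aggDemand, demand, hD]

/-- Raising several prices does not decrease the demand for a good whose price is kept. -/
theorem aggDemand_le_of_le (hG : M.WeakGrossSubstitutes) {p q : Fin m → ℝ} (hp : ∀ j, 0 < p j)
    (hpq : ∀ j, p j ≤ q j) {j : Fin m} (hj : p j = q j) : M.aggDemand p j ≤ M.aggDemand q j := by
  -- Prices are raised one good at a time; the step for `j` itself is void because its price is
  -- kept.
  have key : ∀ S : Finset (Fin m), M.aggDemand p j ≤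
      M.aggDemand (fun k => if k ∈ S then q k else p k) j := by
    intro S
    induction S using Finset.induction_on with
    | empty => simp
    | insert k S hk ih =>
      set r : Fin m → ℝ := fun k => if k ∈ S then q k else p k with hr
      have hr0 : ∀ j, 0 < r j := fun l => by
        simp only [hr]; split_ifs
        exacts [(hp l).trans_le (hpq l), hp l]
      have hup : (fun l => if l ∈ insert k S then q l else p l) = Function.update r k (q k) := by
        ext l
        by_cases h : l = k
        · subst h; simp
        · simp [h, hr]
      rw [hup]
      by_cases h : j = k
      · subst h
        have : Function.update r j (q j) = r := by
          rw [← hj]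
          simp [hr, hk]
        rwa [this]
      · refine ih.trans (hG r hr0 k (q k) ?_ j h)
        simp [hr, hk, hpq k]
  simpa using key Finset.univ

theorem surplus_le_of_le (hG : M.WeakGrossSubstitutes) {p q : Fin m → ℝ} (hp : ∀ j, 0 < p j)
    (hpq : ∀ j, p j ≤ q j) {j : Fin m} (hj : p j = q j) : M.surplus p j ≤ M.surplus q j := by
  have := aggDemand_le_of_le hG hp hpq hj
  unfold surplus
  rw [← hj]
  exact mul_le_mul_of_nonneg_left (by linarith) (hp j).le

theorem aggDemand_eq_one_of_isEquilibrium (hU : M.UniqueDemands) {x : Fin n → Fin m → ℝ}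
    {p : Fin m → ℝ} (hp : ∀ j, 0 < p j) (he : M.IsEquilibrium x p) (j : Fin m) :
    M.aggDemand p j = 1 := by
  rw [← M.endow_total j, ← he.2.2 j]
  exact Finset.sum_congr rfl fun i _ => (congrFun ((he.2.1 i).eq_demand hU hp) j).symm

/-- Multiply the (real) prices of the goods in `S` by `x`. -/
noncomputable def scaled (p : Fin m → ℝ) (x : ℝ) (S : Finset (Fin m)) : Fin m → ℝ :=
  fun i => if i ∈ S then x * p i else p i

theorem scaled_one (p : Fin m → ℝ) (S : Finset (Fin m)) : scaled p 1 S = p := by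
  ext i; simp [scaled]

theorem le_scaled {p : Fin m → ℝ} (hp : ∀ j, 0 ≤ p j) {x : ℝ} (hx : 1 ≤ x) (S : Finset (Fin m))
    (j : Fin m) : p j ≤ scaled p x S j := by
  unfold scaled
  split_ifs
  · nlinarith [hp j]
  · exact le_rfl

theorem surplus_le_surplus_scaled (hG : M.WeakGrossSubstitutes) {p : Fin m → ℝ}
    (hp : ∀ j, 0 < p j) {x : ℝ} (hx : 1 ≤ x) {S : Finset (Fin m)} {j : Fin m} (hj : j ∉ S) :
    M.surplus p j ≤ M.surplus (scaled p x S) j :=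
  surplus_le_of_le hG hp (le_scaled (fun j => (hp j).le) hx S) (by simp [scaled, hj])

/-- By homogeneity, raising the prices in `S` by `x` has the effect of lowering all others by `x`.
This cannot increase demand inside `S`, so only the price factor of the surplus remains. -/
theorem surplus_scaled_le (hG : M.WeakGrossSubstitutes) {p : Fin m → ℝ}
    (hp : ∀ j, 0 < p j) {x : ℝ} (hx : 1 ≤ x) {S : Finset (Fin m)} {j : Fin m} (hj : j ∈ S) :
    M.surplus (scaled p x S) j ≤ x * M.surplus p j := by
  have hx0 : 0 < x := by linarith
  set q : Fin m → ℝ := fun i => if i ∈ S then p i else x⁻¹ * p i with hq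
  have hs : scaled p x S = fun i => x * q i := by
    ext i
    simp only [scaled, hq]
    split_ifs
    · rfl
    · field_simp
  have hq0 : ∀ i, 0 < q i := fun i => by
    simp only [hq]; split_ifs
    · exact hp i
    · exact mul_pos (inv_pos.2 hx0) (hp i)
  have hqp : ∀ i, q i ≤ p i := fun i => by
    simp only [hq]; split_ifs
    · exact le_rfl
    · have : x⁻¹ ≤ 1 := inv_le_one_of_one_le₀ hx
      nlinarith [hp i]
  have h := aggDemand_le_of_le hG hq0 hqp (j := j) (by simp [hq, hj])
  have h2 : scaled p x S j = x * p j := by simp [scaled, hj]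
  unfold surplus
  rw [h2, hs, aggDemand_smul q hx0, mul_assoc]
  exact mul_le_mul_of_nonneg_left (mul_le_mul_of_nonneg_left (by linarith) (hp j).le) hx0.le

/-! ### Truncating prices at an equilibrium -/

theorem surplus_min_nonpos (hG : M.WeakGrossSubstitutes) {p r : Fin m → ℝ}
    (hp : ∀ j, 0 < p j) (hr : ∀ j, 0 < r j) (hr1 : ∀ j, M.aggDemand r j = 1) {j : Fin m}
    (hj : r j ≤ p j) : M.surplus (fun k => min (p k) (r k)) j ≤ 0 := by
  have h : M.surplus (fun k => min (p k) (r k)) j ≤ M.surplus r j :=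
    surplus_le_of_le hG (fun k => lt_min (hp k) (hr k)) (fun _ => min_le_right _ _) (min_eq_right hj)
  have h0 : M.surplus r j = 0 := by simp [surplus, hr1]
  exact h.trans h0.le

theorem surplus_min_le (hG : M.WeakGrossSubstitutes) {p r : Fin m → ℝ}
    (hp : ∀ j, 0 < p j) (hr : ∀ j, 0 < r j) {j : Fin m}
    (hj : p j ≤ r j) : M.surplus (fun k => min (p k) (r k)) j ≤ M.surplus p j :=
  surplus_le_of_le hG (fun k => lt_min (hp k) (hr k)) (fun _ => min_le_left _ _) (min_eq_left hj)

/-- If no good above its equilibrium price has negative surplus, truncating the prices at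
the equilibrium prices does not change any surplus. -/
theorem surplus_min_eq (hm : 1 ≤ m) (hU : M.UniqueDemands) (hG : M.WeakGrossSubstitutes)
    {p r : Fin m → ℝ} (hp : ∀ j, 0 < p j) (hr : ∀ j, 0 < r j) (hr1 : ∀ j, M.aggDemand r j = 1)
    (h : ∀ j, r j < p j → 0 ≤ M.surplus p j) (j : Fin m) :
    M.surplus (fun k => min (p k) (r k)) j = M.surplus p j := by
  have hle : ∀ j ∈ Finset.univ, M.surplus (fun k => min (p k) (r k)) j ≤ M.surplus p j := by
    intro j _
    rcases le_or_gt (p j) (r j) with hj | hj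
    · exact surplus_min_le hG hp hr hj
    · exact (surplus_min_nonpos hG hp hr hr1 hj.le).trans (h j hj)
  -- A termwise inequality between vectors of equal sum (zero, by Walras' law) is an equality.
  refine (Finset.sum_eq_sum_iff_of_le hle).1 ?_ j (Finset.mem_univ j)
  rw [sum_surplus hm hU hp, sum_surplus hm hU fun k => lt_min (hp k) (hr k)]

/-! ### Lipschitz continuity of the surplus on the box -/

theorem abs_surplus_update_sub_le {D₁ D₂ : ℕ} (hD : M.BoundedDerivatives D₁ D₂) {p : Fin m → ℝ}
    (hp : ∀ j, 1 ≤ p j ∧ p j ≤ 2 ^ D₁) (k : Fin m) {t : ℝ} (ht : 1 ≤ t ∧ t ≤ 2 ^ D₁) (i : Fin m) :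
    |M.surplus (Function.update p k t) i - M.surplus p i| ≤ 2 ^ D₂ * |t - p k| := by
  have hd : ∀ y ∈ Set.Icc (1 : ℝ) (2 ^ D₁), ∃ d : ℝ,
      HasDerivAt (fun t => M.surplus (Function.update p k t) i) d y ∧ |d| < 2 ^ D₂ := by
    intro y hy
    have hbox : ∀ j, 1 ≤ Function.update p k y j ∧ Function.update p k y j ≤ 2 ^ D₁ := by
      intro j
      by_cases hj : j = k
      · subst hj; simpa using hy
      · simpa [hj] using hp j
    obtain ⟨d, h1, h2⟩ := hD _ hbox i k
    refine ⟨d, ?_, h2⟩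
    simpa using h1
  choose! d hd1 hd2 using hd
  have := (convex_Icc (1 : ℝ) (2 ^ D₁)).norm_image_sub_le_of_norm_hasDerivWithin_le
    (f := fun t => M.surplus (Function.update p k t) i) (f' := d) (C := 2 ^ D₂)
    (fun y hy => (hd1 y hy).hasDerivWithinAt) (fun y hy => (hd2 y hy).le) (hp k) ht
  simpa using this

/-- Coordinates are exchanged one at a time; every intermediate point takes its entries from `p` and
`q` and so stays in the box. -/
theorem abs_surplus_sub_le {D₁ D₂ : ℕ} (hD : M.BoundedDerivatives D₁ D₂) {p q : Fin m → ℝ}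
    (hp : ∀ j, 1 ≤ p j ∧ p j ≤ 2 ^ D₁) (hq : ∀ j, 1 ≤ q j ∧ q j ≤ 2 ^ D₁) (i : Fin m) :
    |M.surplus q i - M.surplus p i| ≤ 2 ^ D₂ * ∑ j, |q j - p j| := by
  have key : ∀ S : Finset (Fin m),
      |M.surplus (fun k => if k ∈ S then q k else p k) i - M.surplus p i| ≤
        2 ^ D₂ * ∑ j ∈ S, |q j - p j| := by
    intro S
    induction S using Finset.induction_on with
    | empty => simp
    | insert k S hk ih =>
      set r : Fin m → ℝ := fun k => if k ∈ S then q k else p k with hr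
      have hrb : ∀ j, 1 ≤ r j ∧ r j ≤ 2 ^ D₁ := fun l => by
        simp only [hr]; split_ifs
        exacts [hq l, hp l]
      have hup : (fun l => if l ∈ insert k S then q l else p l) = Function.update r k (q k) := by
        ext l
        by_cases h : l = k
        · subst h; simp
        · simp [h, hr]
      have h1 := abs_surplus_update_sub_le hD hrb k (hq k) i
      have hrk : r k = p k := by simp [hr, hk]
      rw [hrk] at h1
      rw [hup, Finset.sum_insert hk, mul_add]
      exact (abs_sub_le _ (M.surplus r i) _).trans (add_le_add h1 ih)
  simpa using key Finset.univ

end ExchangeMarket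

end WGS

namespace WGS

/-! ### Decrease of the sum of the squared positive parts -/

section Potential

variable {ι : Type*} [Fintype ι]

/-- For a fixed total it suffices that no negative part grows, and `h` says this coordinatewise. -/
theorem sum_posPart_le {s s' : ι → ℝ} (hsum : ∑ j, s' j = ∑ j, s j)
    (h : ∀ j, 0 ≤ s' j ∨ s j ≤ s' j) : ∑ j, max (s' j) 0 ≤ ∑ j, max (s j) 0 := by
  have h1 : ∑ j, (max (s' j) 0 - s' j) ≤ ∑ j, (max (s j) 0 - s j) := by
    refine Finset.sum_le_sum fun j _ => ?_
    rcases le_total (s' j) 0 with h1 | h1 <;> rcases le_total (s j) 0 with h2 | h2 <;>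
      rcases h j with h3 | h3 <;> simp only [max_eq_left, max_eq_right, h1, h2] <;> linarith
  simp only [Finset.sum_sub_distrib] at h1
  linarith

/-- Positive and negative parts have the same total, and `|s j|` is a single term of one of the two
sums. -/
theorem abs_le_sum_posPart {s : ι → ℝ} (hsum : ∑ j, s j = 0) (j : ι) :
    |s j| ≤ ∑ j, max (s j) 0 := by
  have h1 : ∀ k ∈ Finset.univ, 0 ≤ max (s k) 0 := fun k _ => le_max_right _ _
  have h2 : ∀ k ∈ Finset.univ, 0 ≤ max (s k) 0 - s k := fun k _ => sub_nonneg.2 (le_max_left _ _)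
  have h3 := Finset.single_le_sum h1 (Finset.mem_univ j)
  have h4 := Finset.single_le_sum h2 (Finset.mem_univ j)
  rw [Finset.sum_sub_distrib, hsum, sub_zero] at h4
  rw [abs_le]
  constructor
  · have := le_max_right (s j) 0
    linarith
  · exact (le_max_left _ _).trans h3

/-- For positive parts u before and v after, v² = u² - (u - v)² - 2v(u - v). Replacing the last
factor v by θ, the least new value on `G`, costs 2(v - θ)(v - u). This is nonpositive where an entry
of `G` falls, at most 2η(1 + η)u² where it rises, and at most 4μv outside `G`. After summation θ
multiplies ∑ (u - v) ≥ 0 and can be dropped, while the squares (u - v)² contribute at least γ². -/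
theorem sum_posPart_sq_le {s s' : ι → ℝ} {G : Finset ι} {η μ γ : ℝ} (hη : 0 ≤ η) (hμ : 0 ≤ μ)
    (hγ : 0 ≤ γ) (hsum : ∑ j, s' j = ∑ j, s j) (hne : G.Nonempty)
    (hG : ∀ i ∈ G, 0 ≤ s i ∧ 0 ≤ s' i ∧ s' i ≤ (1 + η) * s i)
    (hout : ∀ j, j ∉ G → s j ≤ s' j)
    (hord : ∀ i ∈ G, ∀ j, j ∉ G → s' j ≤ s' i + 2 * μ)
    (hgain : (∃ i ∈ G, γ ≤ s i - s' i) ∨ ∃ j, j ∉ G ∧ γ ≤ max (s' j) 0 - max (s j) 0) :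
    ∑ j, max (s' j) 0 ^ 2 ≤
      (1 + 2 * η * (1 + η)) * ∑ j, max (s j) 0 ^ 2 - γ ^ 2 + 4 * μ * ∑ j, max (s j) 0 := by
  obtain ⟨i₀, hi₀, hmin⟩ := G.exists_min_image s' hne
  set θ := s' i₀ with hθ
  have hθ0 : 0 ≤ θ := (hG i₀ hi₀).2.1
  have hterm : ∀ j ∈ Finset.univ, max (s' j) 0 ^ 2 ≤ (1 + 2 * η * (1 + η)) * max (s j) 0 ^ 2 -
      (max (s j) 0 - max (s' j) 0) ^ 2 - 2 * θ * (max (s j) 0 - max (s' j) 0) +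
      4 * μ * max (s' j) 0 := by
    intro j _
    by_cases hj : j ∈ G
    · obtain ⟨h1, h2, h3⟩ := hG j hj
      rw [max_eq_left h1, max_eq_left h2]
      have h4 := hmin j hj
      have h5 : 0 ≤ η * (1 + η) * s j ^ 2 := by positivity
      have h6 : 0 ≤ μ * s' j := mul_nonneg hμ h2
      rcases le_total (s' j) (s j) with h | h
      · nlinarith [mul_nonneg (sub_nonneg.2 h4) (sub_nonneg.2 h)]
      · have : (s' j - θ) * (s' j - s j) ≤ ((1 + η) * s j) * (η * s j) := by
          apply mul_le_mul <;> nlinarith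
        nlinarith
    · have h1 := hout j hj
      have h2 := hord i₀ hi₀ j hj
      set u := max (s j) 0 with hu
      set v := max (s' j) 0 with hv
      have hu0 : 0 ≤ u := le_max_right _ _
      have huv : u ≤ v := max_le_max_right 0 h1
      have hvθ : v ≤ θ + 2 * μ := max_le h2 (by linarith)
      have h5 : 0 ≤ η * (1 + η) * u ^ 2 := by positivity
      have h6 : 0 ≤ μ * v := mul_nonneg hμ (hu0.trans huv)
      rcases le_total v θ with h | h
      · nlinarith [mul_nonneg (sub_nonneg.2 h) (sub_nonneg.2 huv)]
      · have : (v - θ) * (v - u) ≤ (2 * μ) * v := by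
          apply mul_le_mul <;> linarith
        nlinarith
  have hS := Finset.sum_le_sum hterm
  simp only [Finset.sum_add_distrib, Finset.sum_sub_distrib, ← Finset.mul_sum] at hS
  have hl1 : ∑ j, max (s' j) 0 ≤ ∑ j, max (s j) 0 := by
    refine sum_posPart_le hsum fun j => ?_
    by_cases hj : j ∈ G
    · exact Or.inl (hG j hj).2.1
    · exact Or.inr (hout j hj)
  have hsq : γ ^ 2 ≤ ∑ j, (max (s j) 0 - max (s' j) 0) ^ 2 := by
    have hnn : ∀ k ∈ Finset.univ, 0 ≤ (max (s k) 0 - max (s' k) 0) ^ 2 := fun _ _ => sq_nonneg _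
    rcases hgain with ⟨i, hi, h⟩ | ⟨j, hj, h⟩
    · refine le_trans ?_ (Finset.single_le_sum hnn (Finset.mem_univ i))
      rw [max_eq_left (hG i hi).1, max_eq_left (hG i hi).2.1]
      exact pow_le_pow_left₀ hγ h 2
    · refine le_trans ?_ (Finset.single_le_sum hnn (Finset.mem_univ j))
      rw [← neg_sq (max (s j) 0 - _), neg_sub]
      exact pow_le_pow_left₀ hγ h 2
  nlinarith [mul_nonneg hθ0 (sub_nonneg.2 hl1), mul_nonneg hμ (sub_nonneg.2 hl1)]

end Potential

/-! ### The goods of largest surplus -/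

section TopGoods

variable {m : ℕ} {s : Fin m → ℚ} {μ : ℚ}

theorem head_mem_gapPrefix (i : Fin m) (l : List (Fin m)) : i ∈ gapPrefix s μ (i :: l) := by
  cases l with
  | nil => simp [gapPrefix]
  | cons j l => unfold gapPrefix; split_ifs <;> simp

/-- The break is tested only between two neighbours in the list; sortedness carries it to all pairs
on opposite sides. -/
theorem gap_of_mem_gapPrefix : ∀ {l : List (Fin m)}, l.Pairwise (fun i j => s j ≤ s i) →
    ∀ i ∈ gapPrefix s μ l, ∀ j ∈ l, j ∉ gapPrefix s μ l →
      s j ≤ μ ∨ (1 + 1 / (m : ℚ)) * s j < s i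
  | [], _, i, hi, _, _, _ => by simp [gapPrefix] at hi
  | [k], _, i, _, j, hj, hj' => by simp_all [gapPrefix]
  | k :: k' :: l, hl, i, hi, j, hj, hj' => by
    have h1 : (0 : ℚ) < 1 + 1 / (m : ℚ) := by positivity
    obtain ⟨hk, hl'⟩ := List.pairwise_cons.1 hl
    unfold gapPrefix at hi hj'
    split_ifs at hi hj' with hc
    · simp only [List.mem_singleton] at hi hj'
      subst hi
      have hj2 : j ∈ k' :: l := (List.mem_cons.1 hj).resolve_left hj'
      have hle : s j ≤ s k' := by
        rcases List.mem_cons.1 hj2 with rfl | h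
        · exact le_rfl
        · exact (List.pairwise_cons.1 hl').1 j h
      rcases hc with hc | hc
      · exact Or.inl (hle.trans hc)
      · exact Or.inr ((mul_le_mul_of_nonneg_left hle h1.le).trans_lt hc)
    · simp only [List.mem_cons, not_or] at hj'
      have hj2 : j ∈ k' :: l := (List.mem_cons.1 hj).resolve_left hj'.1
      rcases List.mem_cons.1 hi with rfl | hi
      · exact (gap_of_mem_gapPrefix hl' k' (head_mem_gapPrefix _ _) j hj2 hj'.2).imp_right
          fun h => h.trans_le (hk k' (by simp))
      · exact gap_of_mem_gapPrefix hl' i hi j hj2 hj'.2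

/-- Before the break each neighbour loses at most a factor 1 + 1/m, and these factors compound. Over
at most m goods the product stays below e < 3. -/
theorem head_le_of_mem_gapPrefix (hμ : 0 < μ) : ∀ (l : List (Fin m)) (k : Fin m), μ < s k →
    ∀ i ∈ gapPrefix s μ (k :: l), μ < s i ∧ s k ≤ (1 + 1 / (m : ℚ)) ^ l.length * s i
  | [], k, hk, i, hi => by
    simp only [gapPrefix, List.mem_singleton] at hi
    subst hi
    simpa using hk
  | k' :: l, k, hk, i, hi => by
    have h1 : (1 : ℚ) ≤ 1 + 1 / (m : ℚ) := le_add_of_nonneg_right (by positivity)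
    have hself : μ < s k ∧ s k ≤ (1 + 1 / (m : ℚ)) ^ (k' :: l).length * s k :=
      ⟨hk, le_mul_of_one_le_left (hμ.trans hk).le (one_le_pow₀ h1)⟩
    unfold gapPrefix at hi
    split_ifs at hi with hc
    · simp only [List.mem_singleton] at hi
      subst hi
      exact hself
    · push Not at hc
      rcases List.mem_cons.1 hi with rfl | hi
      · exact hself
      · obtain ⟨h2, h3⟩ := head_le_of_mem_gapPrefix hμ l k' hc.1 i hi
        refine ⟨h2, hc.2.trans ?_⟩
        rw [List.length_cons, pow_succ', mul_assoc]
        exact mul_le_mul_of_nonneg_left h3 (by linarith)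

theorem one_add_inv_pow_le_three {m k : ℕ} (hk : k ≤ m) : (1 + 1 / (m : ℚ)) ^ k ≤ 3 := by
  have h1 : (1 : ℚ) ≤ 1 + 1 / (m : ℚ) := le_add_of_nonneg_right (by positivity)
  refine (pow_le_pow_right₀ h1 hk).trans ?_
  rcases Nat.eq_zero_or_pos m with rfl | hm
  · norm_num
  have h2 : ((1 + 1 / (m : ℝ)) ^ m : ℝ) ≤ 3 := by
    have h3 : 1 + 1 / (m : ℝ) ≤ Real.exp (1 / m) := by
      rw [add_comm]; exact Real.add_one_le_exp _
    calc (1 + 1 / (m : ℝ)) ^ m ≤ Real.exp (1 / m) ^ m := pow_le_pow_left₀ (by positivity) h3 m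
      _ = Real.exp 1 := by
        rw [← Real.exp_nat_mul, mul_one_div_cancel (by positivity)]
      _ ≤ 3 := (Real.exp_one_lt_d9.trans (by norm_num)).le
  have h4 : (((1 + 1 / (m : ℚ)) ^ m : ℚ) : ℝ) ≤ ((3 : ℚ) : ℝ) := by
    push_cast
    exact h2
  exact_mod_cast h4

theorem topGoods_spec (hm : 1 ≤ m) (s : Fin m → ℚ) (hμ : 0 < μ) :
    (topGoods s μ).Nonempty ∧
    (∀ i ∈ topGoods s μ, ∀ j, j ∉ topGoods s μ → s j ≤ μ ∨ (1 + 1 / (m : ℚ)) * s j < s i) ∧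
    ((∃ j, μ < s j) → ∀ i ∈ topGoods s μ, μ < s i ∧ ∀ j, s j ≤ 3 * s i) := by
  set r : Fin m → Fin m → Prop := fun i j => s j ≤ s i with hr
  have : Std.Total r := ⟨fun i j => le_total (s j) (s i)⟩
  have : IsTrans (Fin m) r := ⟨fun i j k h1 h2 => le_trans h2 h1⟩
  set l := (List.finRange m).insertionSort r with hl
  have hlp : l.Pairwise r := List.pairwise_insertionSort r _
  have hmem : ∀ i, i ∈ l := fun i => by simp [hl]
  have hlen : l.length = m := by simp [hl]
  have htop : ∀ i, i ∈ topGoods s μ ↔ i ∈ gapPrefix s μ l := fun i => by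
    simp only [topGoods, List.mem_toFinset, hl, hr]
  simp only [htop, Finset.Nonempty]
  refine ⟨?_, fun i hi j hj => gap_of_mem_gapPrefix hlp i hi j (hmem j) hj, ?_⟩
  · cases hl' : l with
    | nil => rw [hl'] at hlen; simp at hlen; omega
    | cons k l' => exact ⟨k, head_mem_gapPrefix k l'⟩
  · rintro ⟨j₀, hj₀⟩ i hi
    cases hl' : l with
    | nil => rw [hl'] at hlen; simp at hlen; omega
    | cons k l' =>
      rw [hl'] at hlp hlen hi hmem
      have hk : ∀ j, s j ≤ s k := fun j => by
        rcases List.mem_cons.1 (hmem j) with rfl | h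
        · exact le_rfl
        · exact (List.pairwise_cons.1 hlp).1 j h
      obtain ⟨h1, h2⟩ := head_le_of_mem_gapPrefix hμ l' k (hj₀.trans_le (hk j₀)) i hi
      refine ⟨h1, fun j => (hk j).trans (h2.trans ?_)⟩
      refine mul_le_mul_of_nonneg_right (one_add_inv_pow_le_three ?_) (hμ.trans h1).le
      rw [List.length_cons] at hlen
      omega

end TopGoods

end WGS

namespace WGS

open ExchangeMarket

/-! ### Analysis of one round -/

namespace ExchangeMarket

variable {n m : ℕ} {M : ExchangeMarket n m}

/-- The invariant of the price vectors: prices are at least one, and goods with a larger price have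
nonnegative surplus. -/
def Admissible (M : ExchangeMarket n m) (p : Fin m → ℝ) : Prop :=
  (∀ j, 1 ≤ p j) ∧ ∀ j, 1 < p j → 0 ≤ M.surplus p j

theorem Admissible.pos {p : Fin m → ℝ} (h : M.Admissible p) (j : Fin m) : 0 < p j :=
  zero_lt_one.trans_le (h.1 j)

theorem admissible_one : M.Admissible (fun _ => 1) :=
  ⟨fun _ => le_rfl, fun _ h => absurd h (lt_irrefl _)⟩

/-- Outside `S` the price is kept and WGS does not lower the surplus, so only `S` needs checking; a
passed test provides exactly that. -/
theorem Admissible.scaled (hG : M.WeakGrossSubstitutes) {p : Fin m → ℝ} (h : M.Admissible p)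
    {x : ℝ} (hx : 1 ≤ x) {S : Finset (Fin m)}
    (hS : ∀ i ∈ S, 0 ≤ M.surplus (scaled p x S) i) : M.Admissible (scaled p x S) := by
  refine ⟨fun j => (h.1 j).trans (le_scaled (fun j => (h.pos j).le) hx S j), fun j hj => ?_⟩
  by_cases hjS : j ∈ S
  · exact hS j hjS
  · rw [ExchangeMarket.scaled, if_neg hjS] at hj
    exact (h.2 j hj).trans (surplus_le_surplus_scaled hG h.pos hx hjS)

/-- Only goods of price one can have negative surplus, and there it is demand minus one, hence at
least -1. Walras' law transfers the bound to the positive parts. -/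
theorem Admissible.sum_posPart_le (hm : 1 ≤ m) (hU : M.UniqueDemands) {p : Fin m → ℝ}
    (h : M.Admissible p) : ∑ j, max (M.surplus p j) 0 ≤ m := by
  have h1 : ∑ j, (max (M.surplus p j) 0 - M.surplus p j) ≤ ∑ _j : Fin m, (1 : ℝ) := by
    refine Finset.sum_le_sum fun j _ => ?_
    rcases (h.1 j).eq_or_lt with hj | hj
    · have := aggDemand_nonneg hU h.pos j
      have hs : M.surplus p j = M.aggDemand p j - 1 := by rw [surplus, ← hj, one_mul]
      rcases max_cases (M.surplus p j) 0 with hc | hc <;> linarith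
    · rw [max_eq_left (h.2 j hj)]
      linarith
  rw [Finset.sum_sub_distrib, sum_surplus hm hU h.pos] at h1
  simpa using h1

theorem sum_posPart_scaled_le (hm : 1 ≤ m) (hU : M.UniqueDemands) (hG : M.WeakGrossSubstitutes)
    {p : Fin m → ℝ} (h : ∀ j, 0 < p j) {x : ℝ} (hx : 1 ≤ x) {S : Finset (Fin m)}
    (hS : ∀ i ∈ S, 0 ≤ M.surplus (scaled p x S) i) :
    ∑ j, max (M.surplus (scaled p x S) j) 0 ≤ ∑ j, max (M.surplus p j) 0 := by
  refine WGS.sum_posPart_le ?_ fun j => ?_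
  · rw [sum_surplus hm hU h,
      sum_surplus hm hU fun j => (h j).trans_le (le_scaled (fun j => (h j).le) hx S j)]
  · by_cases hj : j ∈ S
    · exact Or.inl (hS j hj)
    · exact Or.inr (surplus_le_surplus_scaled hG h hx hj)

/-- A good priced above `r j ≥ 1` is priced above one, so admissibility supplies the sign condition.
The point is that the capped prices lie in the box whenever `r` does. -/
theorem Admissible.surplus_min_eq (hm : 1 ≤ m) (hU : M.UniqueDemands)
    (hG : M.WeakGrossSubstitutes) {p r : Fin m → ℝ} (h : M.Admissible p) (hr : ∀ j, 1 ≤ r j)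
    (hr1 : ∀ j, M.aggDemand r j = 1) (j : Fin m) :
    M.surplus (fun k => min (p k) (r k)) j = M.surplus p j :=
  ExchangeMarket.surplus_min_eq hm hU hG h.pos (fun j => zero_lt_one.trans_le (hr j)) hr1
    (fun j hj => h.2 j ((hr j).trans_lt hj)) j

theorem Admissible.surplus_nonpos (hm : 1 ≤ m) (hU : M.UniqueDemands)
    (hG : M.WeakGrossSubstitutes) {p r : Fin m → ℝ} (h : M.Admissible p) (hr : ∀ j, 1 ≤ r j)
    (hr1 : ∀ j, M.aggDemand r j = 1) {j : Fin m} (hj : r j ≤ p j) : M.surplus p j ≤ 0 := by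
  rw [← h.surplus_min_eq hm hU hG hr hr1]
  exact surplus_min_nonpos hG h.pos (fun j => zero_lt_one.trans_le (hr j)) hr1 hj

end ExchangeMarket

/-- `s` approximates `t` up to `μ` in every entry. -/
def Approximates {m : ℕ} (s : Fin m → ℚ) (t : Fin m → ℝ) (μ : ℚ) : Prop :=
  ∀ j, |(s j : ℝ) - t j| ≤ (μ : ℝ)

/-! ### Size and separation of the exact surpluses of the top goods -/

section Gap

variable {m : ℕ} {s : Fin m → ℝ} {s₀ : Fin m → ℚ} {μ : ℚ} {k : Fin m}

theorem quarter_le_of_mem_topGoods (hm : 1 ≤ m) (hμ : 0 < μ) (hs : Approximates s₀ s μ)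
    (hk : 12800 * (m : ℝ) ^ 3 * μ ≤ s k) {i : Fin m} (hi : i ∈ topGoods s₀ μ) :
    0 < (s₀ i : ℝ) ∧ s k - μ ≤ 3 * (s₀ i : ℝ) ∧ s k / 4 ≤ s i := by
  have hμ' : (0 : ℝ) < μ := by exact_mod_cast hμ
  have hm' : (1 : ℝ) ≤ m := by exact_mod_cast hm
  have hm3 : (1 : ℝ) ≤ (m : ℝ) ^ 3 := one_le_pow₀ hm'
  have hk' : 12800 * (μ : ℝ) ≤ s k := by nlinarith
  have h0 := abs_le.1 (hs k)
  have h1 := abs_le.1 (hs i)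
  have h2 : μ < s₀ k := by
    have : (μ : ℝ) < s₀ k := by linarith
    exact_mod_cast this
  obtain ⟨h3, h4⟩ := (topGoods_spec hm s₀ hμ).2.2 ⟨k, h2⟩ i hi
  have h5 : (s₀ k : ℝ) ≤ 3 * s₀ i := by exact_mod_cast h4 k
  have h6 : (μ : ℝ) < s₀ i := by exact_mod_cast h3
  refine ⟨by linarith, by linarith, by linarith⟩

/-- A ratio 1 + 1/m between approximate surpluses is a difference of at least `s₀ i / (2m)`, and `3
* s₀ i` is at least `s k - μ`. The oracle errors are absorbed in passing from 6m to 8m. -/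
theorem gap_le_of_mem_topGoods (hm : 1 ≤ m) (hμ : 0 < μ) (hs : Approximates s₀ s μ)
    (hk : 12800 * (m : ℝ) ^ 3 * μ ≤ s k) {i j : Fin m} (hi : i ∈ topGoods s₀ μ)
    (hj : j ∉ topGoods s₀ μ) : s k / (8 * m) ≤ s i - max (s j) 0 := by
  have hμ' : (0 : ℝ) < μ := by exact_mod_cast hμ
  have hm' : (1 : ℝ) ≤ m := by exact_mod_cast hm
  have hm2 : (1 : ℝ) ≤ (m : ℝ) ^ 2 := one_le_pow₀ hm'
  have hmμ : (μ : ℝ) ≤ m * μ := by nlinarith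
  have hk1 : 12800 * ((m : ℝ) * μ) ≤ s k := by
    have : (m : ℝ) * μ * 1 ≤ (m : ℝ) * μ * m ^ 2 := mul_le_mul_of_nonneg_left hm2 (by positivity)
    nlinarith
  obtain ⟨h0, h1, h2⟩ := quarter_le_of_mem_topGoods hm hμ hs hk hi
  have hi' := abs_le.1 (hs i)
  have hj' := abs_le.1 (hs j)
  have hk0 : 0 < s k := by linarith
  have hbig : s k / (8 * m) ≤ s k / 8 := by
    apply div_le_div_of_nonneg_left hk0.le (by norm_num) (by linarith)
  rcases le_total (s j) 0 with hj0 | hj0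
  · rw [max_eq_right hj0]
    linarith
  rw [max_eq_left hj0]
  rcases (topGoods_spec hm s₀ hμ).2.1 i hi j hj with h | h
  · have h' : (s₀ j : ℝ) ≤ μ := by exact_mod_cast h
    linarith
  · have h' : (1 + 1 / (m : ℝ)) * s₀ j < s₀ i := by
      have : ((((1 + 1 / (m : ℚ)) * s₀ j : ℚ)) : ℝ) < ((s₀ i : ℚ) : ℝ) := by exact_mod_cast h
      push_cast at this
      exact this
    have h3 : ((m : ℝ) + 1) * s₀ j < m * s₀ i := by
      have := mul_lt_mul_of_pos_left h' (by linarith : (0 : ℝ) < m)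
      rwa [← mul_assoc, mul_add, mul_one, mul_one_div_cancel (by linarith)] at this
    have h4 : 0 ≤ (s₀ i : ℝ) - s₀ j := by nlinarith
    have h5 : (s₀ i : ℝ) ≤ 2 * (m * (s₀ i - s₀ j)) := by nlinarith
    have h6 : (m : ℝ) * (s₀ i - s₀ j) ≤ m * (s i - s j + 2 * μ) :=
      mul_le_mul_of_nonneg_left (by linarith) (by linarith)
    rw [div_le_iff₀ (by linarith)]
    nlinarith

end Gap

/-! ### Passed tests and final brackets -/

section Round

variable {n m : ℕ} {M : ExchangeMarket n m}

theorem nonneg_of_searchCond {s : Fin m → ℝ} {s₁ : Fin m → ℚ} {μ : ℚ} {G : Finset (Fin m)}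
    (hs : Approximates s₁ s μ) (h : SearchCond s₁ μ G) {i : Fin m} (hi : i ∈ G) : 0 ≤ s i := by
  have h1 := abs_le.1 (hs i)
  have h2 : (μ : ℝ) ≤ s₁ i := by exact_mod_cast (h i hi).1
  linarith

/-- The brackets `a / b < c / d` in the binary search for the price factor, for the
outcomes `pass a b` of the tests. -/
structure IsBracket (N : ℕ) (pass : ℕ → ℕ → Prop) (a b c d : ℕ) : Prop where
  one_le_b : 1 ≤ b
  b_le_a : b ≤ a
  one_le_c : 1 ≤ c
  d_le_c : d ≤ c
  det : c * b = a * d + 1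
  lower : (a = 1 ∧ b = 1) ∨ pass a b
  upper : d = 0 ∨ ¬ pass c d
  a_le : a ≤ max N 1

theorem IsBracket.one_le_div {N : ℕ} {pass : ℕ → ℕ → Prop} {a b c d : ℕ}
    (h : IsBracket N pass a b c d) : (1 : ℝ) ≤ (a : ℝ) / b := by
  have hb : (0 : ℝ) < b := by exact_mod_cast h.one_le_b
  rw [_root_.one_le_div hb]
  exact_mod_cast h.b_le_a

/-- The determinant makes the gap equal to 1/(bd), and N < a + c with c ≤ ad + 1 gives N ≤ 2ad. The
bound is relative to a/b, since the factor itself has no a priori bound. -/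
theorem IsBracket.div_sub_div_le {N : ℕ} {pass : ℕ → ℕ → Prop} {a b c d : ℕ}
    (h : IsBracket N pass a b c d) (hd : d ≠ 0) (hN : N < a + c) :
    0 ≤ (c : ℝ) / d - (a : ℝ) / b ∧
      ((c : ℝ) / d - (a : ℝ) / b) * N ≤ 2 * ((a : ℝ) / b) := by
  have hb : (0 : ℝ) < b := by exact_mod_cast h.one_le_b
  have ha : (1 : ℝ) ≤ a := by exact_mod_cast h.one_le_b.trans h.b_le_a
  have hd1 : (1 : ℝ) ≤ d := by exact_mod_cast Nat.one_le_iff_ne_zero.2 hd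
  have hdet : (c : ℝ) * b = a * d + 1 := by exact_mod_cast h.det
  have heq : (c : ℝ) / d - (a : ℝ) / b = 1 / (b * d) := by
    field_simp
    linarith
  have hN' : (N : ℝ) ≤ 2 * (a * d) := by
    have h1 : c ≤ a * d + 1 := by
      rw [← h.det]; exact Nat.le_mul_of_pos_right c h.one_le_b
    have h2 : a ≤ a * d := Nat.le_mul_of_pos_right a (Nat.pos_of_ne_zero hd)
    have : N ≤ 2 * (a * d) := by omega
    exact_mod_cast this
  rw [heq]
  refine ⟨by positivity, ?_⟩
  rw [div_mul_eq_mul_div, one_mul, div_le_iff₀ (by positivity)]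
  have : 2 * ((a : ℝ) / b) * (b * d) = 2 * (a * d) := by field_simp
  linarith

end Round

end WGS

namespace WGS

open ExchangeMarket

/-! ### Decrease of the squared positive surpluses in one round -/

section RoundProgress

variable {n m : ℕ} {M : ExchangeMarket n m}

/-- If all of `G` were priced above equilibrium, its surpluses would be nonpositive, and the passed
test would push every other surplus down to at most 2μ. -/
theorem exists_le_equilibrium (hm : 1 ≤ m) (hU : M.UniqueDemands) (hG : M.WeakGrossSubstitutes)
    {p r : Fin m → ℝ} (hp : M.Admissible p) (hr : ∀ j, 1 ≤ r j) (hr1 : ∀ j, M.aggDemand r j = 1)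
    {G : Finset (Fin m)} (hne : G.Nonempty) {s₁ : Fin m → ℚ} {μ : ℚ}
    (hs : Approximates s₁ (M.surplus p) μ) (hpass : SearchCond s₁ μ G) {k : Fin m}
    (hk : 2 * (μ : ℝ) < M.surplus p k) (hμ : 0 < μ) : ∃ i ∈ G, p i ≤ r i := by
  by_contra! hcon
  have hμ' : (0 : ℝ) < μ := by exact_mod_cast hμ
  have h0 : ∀ i ∈ G, M.surplus p i ≤ 0 := fun i hi =>
    hp.surplus_nonpos hm hU hG hr hr1 (hcon i hi).le
  by_cases hkG : k ∈ G
  · linarith [h0 k hkG]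
  · obtain ⟨i, hi⟩ := hne
    have h1 : (s₁ k : ℝ) ≤ s₁ i := by exact_mod_cast (hpass i hi).2 k hkG
    have h2 := abs_le.1 (hs k)
    have h3 := abs_le.1 (hs i)
    linarith [h0 i hi]

/-- The surpluses at two consecutive price factors, truncated at the equilibrium, are close. -/
theorem abs_surplus_min_scaled_sub_le {D₁ D₂ : ℕ} (hD : M.BoundedDerivatives D₁ D₂)
    {p r : Fin m → ℝ} (hp : ∀ j, 1 ≤ p j) (hr : ∀ j, 1 ≤ r j ∧ r j ≤ 2 ^ D₁) {x y ν L : ℝ}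
    (hx : 1 ≤ x) (hxy : x ≤ y) (hL : 0 < L) (hyL : (y - x) * L ≤ 2 * x)
    (hν : m * 2 ^ (D₁ + D₂) ≤ 2 * ν * L) (G : Finset (Fin m)) (i : Fin m) :
    |M.surplus (fun k => min (scaled p y G k) (r k)) i -
      M.surplus (fun k => min (scaled p x G k) (r k)) i| ≤ 4 * ν := by
  have hp0 : ∀ j, 0 ≤ p j := fun j => zero_le_one.trans (hp j)
  have hbox : ∀ z, 1 ≤ z → ∀ j, 1 ≤ min (scaled p z G j) (r j) ∧
      min (scaled p z G j) (r j) ≤ 2 ^ D₁ := fun z hz j =>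
    ⟨le_min ((hp j).trans (le_scaled hp0 hz G j)) (hr j).1, (min_le_right _ _).trans (hr j).2⟩
  have hterm : ∀ j ∈ Finset.univ, |min (scaled p y G j) (r j) - min (scaled p x G j) (r j)| ≤
      2 ^ D₁ * (2 / L) := by
    intro j _
    have h0 : (0 : ℝ) ≤ 2 ^ D₁ * (2 / L) := by positivity
    by_cases hj : j ∈ G
    · simp only [scaled, if_pos hj]
      have hle : x * p j ≤ y * p j := mul_le_mul_of_nonneg_right hxy (hp0 j)
      rw [abs_of_nonneg (sub_nonneg.2 (min_le_min_right _ hle))]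
      rcases le_total (r j) (x * p j) with h | h
      · rw [min_eq_right h, min_eq_right (h.trans hle), sub_self]
        exact h0
      · rw [min_eq_left h]
        have h1 : min (y * p j) (r j) ≤ y * p j := min_le_left _ _
        -- Here x p_j ≤ r_j ≤ 2^D₁, so the relative gap between the factors becomes an absolute
        -- bound on the price change.
        have h2 : (y - x) * p j * L ≤ 2 * 2 ^ D₁ := by
          nlinarith [mul_le_mul_of_nonneg_right hyL (hp0 j), (hr j).2]
        have h3 : (y - x) * p j ≤ 2 ^ D₁ * (2 / L) := by
          rw [mul_div_assoc', le_div_iff₀ hL]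
          linarith
        linarith
    · simp only [scaled, if_neg hj, sub_self, abs_zero]
      exact h0
  refine (abs_surplus_sub_le hD (hbox x hx) (hbox y (hx.trans hxy)) i).trans ?_
  refine (mul_le_mul_of_nonneg_left (Finset.sum_le_sum hterm) (by positivity)).trans ?_
  rw [Finset.sum_const, Finset.card_univ, Fintype.card_fin, nsmul_eq_mul]
  have : (2 : ℝ) ^ D₂ * (m * (2 ^ D₁ * (2 / L))) = 2 * (m * 2 ^ (D₁ + D₂)) / L := by
    rw [pow_add]; ring
  rw [this, div_le_iff₀ hL]
  linarith

/-- What a failed test says about the surpluses truncated at the equilibrium. -/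
theorem exists_of_not_searchCond (hm : 1 ≤ m) (hU : M.UniqueDemands)
    (hG : M.WeakGrossSubstitutes) {p r : Fin m → ℝ} (hp : M.Admissible p) (hr : ∀ j, 1 ≤ r j)
    (hr1 : ∀ j, M.aggDemand r j = 1) {G : Finset (Fin m)} {y : ℝ} (hy : 1 ≤ y)
    {s₂ : Fin m → ℚ} {μ : ℚ} (hs : Approximates s₂ (M.surplus (scaled p y G)) μ) (hμ : 0 < μ)
    (hfail : ¬ SearchCond s₂ μ G) :
    (∃ i ∈ G, M.surplus (fun k => min (scaled p y G k) (r k)) i ≤ 2 * μ) ∨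
    ∃ i ∈ G, ∃ j, j ∉ G ∧ M.surplus (fun k => min (scaled p y G k) (r k)) i ≤
      M.surplus (fun k => min (scaled p y G k) (r k)) j + 2 * μ := by
  have hμ' : (0 : ℝ) < μ := by exact_mod_cast hμ
  have hr0 : ∀ j, 0 < r j := fun j => zero_lt_one.trans_le (hr j)
  have hq0 : ∀ j, 0 < scaled p y G j := fun j =>
    (hp.pos j).trans_le (le_scaled (fun j => (hp.pos j).le) hy G j)
  -- The prices at `y` need not be admissible. If a test value is below μ, the WGS upper bounds for
  -- capped surpluses suffice; otherwise admissibility holds and capping changes nothing.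
  by_cases hlow : ∃ i ∈ G, s₂ i < μ
  · obtain ⟨i, hi, hlt⟩ := hlow
    refine Or.inl ⟨i, hi, ?_⟩
    have h1 : (s₂ i : ℝ) < μ := by exact_mod_cast hlt
    have h2 := abs_le.1 (hs i)
    rcases le_total (scaled p y G i) (r i) with h | h
    · linarith [surplus_min_le hG hq0 hr0 h]
    · linarith [surplus_min_nonpos hG hq0 hr0 hr1 h]
  · push Not at hlow
    have hnn : ∀ i ∈ G, 0 ≤ M.surplus (scaled p y G) i := fun i hi => by
      have h1 : (μ : ℝ) ≤ s₂ i := by exact_mod_cast hlow i hi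
      have h2 := abs_le.1 (hs i)
      linarith
    have hq := hp.scaled hG hy hnn
    unfold SearchCond at hfail
    push Not at hfail
    obtain ⟨i, hi, hij⟩ := hfail
    obtain ⟨j, hj, hlt⟩ := hij (hlow i hi)
    refine Or.inr ⟨i, hi, j, hj, ?_⟩
    rw [hq.surplus_min_eq hm hU hG hr hr1, hq.surplus_min_eq hm hU hG hr hr1]
    have h1 : (s₂ i : ℝ) < s₂ j := by exact_mod_cast hlt
    have h2 := abs_le.1 (hs i)
    have h3 := abs_le.1 (hs j)
    linarith

/-- The exponent 4 is chosen because 1 - κ ≥ 1/2 may halve the linear term 4η, leaving the 2η needed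
on the left. -/
theorem one_add_sub_le_mul_pow {η κ : ℝ} (hη : 0 ≤ η) (hκ' : κ ≤ 1 / 2) :
    1 + 2 * η * (1 + η) - κ ≤ (1 - κ) * (1 + η) ^ 4 := by
  have h1 : 1 + 4 * η + 6 * η ^ 2 ≤ (1 + η) ^ 4 := by
    nlinarith [pow_nonneg hη 3, pow_nonneg hη 4]
  have h2 : (1 - κ) * (1 + 4 * η + 6 * η ^ 2) ≤ (1 - κ) * (1 + η) ^ 4 :=
    mul_le_mul_of_nonneg_left h1 (by linarith)
  nlinarith [mul_nonneg hη (sub_nonneg.2 hκ'), mul_nonneg (sq_nonneg η) (sub_nonneg.2 hκ')]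

/-- Unless all surpluses are small after a round, the sum of the squared positive parts
of the surpluses decreases, up to the effect of the price factor. -/
theorem round_progress (hm : 1 ≤ m) (hU : M.UniqueDemands)
    (hG : M.WeakGrossSubstitutes) {D₁ D₂ : ℕ} (hD : M.BoundedDerivatives D₁ D₂)
    {p r : Fin m → ℝ} (hp : M.Admissible p) (hr : ∀ j, 1 ≤ r j ∧ r j ≤ 2 ^ D₁)
    (hr1 : ∀ j, M.aggDemand r j = 1) {μ : ℚ} (hμ : 0 < μ) {N : ℕ} (hN : (2 : ℝ) ^ D₁ < N)
    (hνN : m * 2 ^ (D₁ + D₂) ≤ 2 * (μ : ℝ) * N) {s₀ : Fin m → ℚ}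
    (hs₀ : Approximates s₀ (M.surplus p) μ) {S : ℕ → ℕ → Fin m → ℚ}
    (hS : ∀ a b : ℕ, 1 ≤ b → b ≤ a →
      Approximates (S a b) (M.surplus (scaled p ((a : ℝ) / b) (topGoods s₀ μ))) μ)
    {a b c d : ℕ}
    (hB : IsBracket N (fun a b => SearchCond (S a b) μ (topGoods s₀ μ)) a b c d)
    (hac : N < a + c)
    {k k' : Fin m} (hk : 12800 * (m : ℝ) ^ 3 * μ ≤ M.surplus p k)
    (hk' : 2 * (μ : ℝ) < M.surplus (scaled p ((a : ℝ) / b) (topGoods s₀ μ)) k') :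
    ∑ j, max (M.surplus (scaled p ((a : ℝ) / b) (topGoods s₀ μ)) j) 0 ^ 2 ≤
      (1 - 1 / (800 * (m : ℝ) ^ 3)) * ((a : ℝ) / b) ^ 4 * ∑ j, max (M.surplus p j) 0 ^ 2 ∧
    ∃ i ∈ topGoods s₀ μ, (a : ℝ) / b * p i ≤ r i := by
  set G := topGoods s₀ μ with hGdef
  set x : ℝ := (a : ℝ) / b with hxdef
  have hμ' : (0 : ℝ) < μ := by exact_mod_cast hμ
  have hm' : (1 : ℝ) ≤ m := by exact_mod_cast hm
  have hm2 : (1 : ℝ) ≤ (m : ℝ) ^ 2 := one_le_pow₀ hm'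
  have hne : G.Nonempty := (topGoods_spec hm s₀ hμ).1
  have hx : 1 ≤ x := hB.one_le_div
  have hSx := hS a b hB.one_le_b hB.b_le_a
  rw [← hxdef] at hSx
  have hr' : ∀ j, 1 ≤ r j := fun j => (hr j).1
  -- replace `k` by a good of maximal surplus
  have : Nonempty (Fin m) := ⟨k⟩
  obtain ⟨k₁, hmax⟩ := Finite.exists_max (M.surplus p)
  replace hk := hk.trans (hmax k)
  set A := M.surplus p k₁ with hA
  have hAm : 12800 * (m * (μ : ℝ)) ≤ A := by
    have : (m : ℝ) * μ * 1 ≤ (m : ℝ) * μ * m ^ 2 := mul_le_mul_of_nonneg_left hm2 (by positivity)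
    nlinarith
  have hmμ : (μ : ℝ) ≤ m * μ := by nlinarith
  have hA0 : 0 < A := by linarith
  have hquarter : ∀ i ∈ G, A / 4 ≤ M.surplus p i := fun i hi =>
    (quarter_le_of_mem_topGoods hm hμ hs₀ hk hi).2.2
  have hpass : x = 1 ∨ SearchCond (S a b) μ G := by
    rcases hB.lower with ⟨h1, h2⟩ | h
    · left; rw [hxdef, h1, h2]; norm_num
    · exact Or.inr h
  have hnn : ∀ i ∈ G, 0 ≤ M.surplus (scaled p x G) i := fun i hi => by
    rcases hpass with h | h
    · rw [h, scaled_one]; linarith [hquarter i hi]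
    · exact nonneg_of_searchCond hSx h hi
  have hp' := hp.scaled hG hx hnn
  have hex : ∃ i ∈ G, scaled p x G i ≤ r i := by
    rcases hpass with h | h
    · obtain ⟨i, hi⟩ := hne
      refine ⟨i, hi, ?_⟩
      rw [h, scaled_one]
      by_contra! hcon
      linarith [hquarter i hi, hp.surplus_nonpos hm hU hG hr' hr1 hcon.le]
    · exact exists_le_equilibrium hm hU hG hp' hr' hr1 hne hSx h hk' hμ
  have hex' : ∃ i ∈ G, x * p i ≤ r i := by
    obtain ⟨i, hi, h⟩ := hex
    exact ⟨i, hi, by simpa [scaled, hi] using h⟩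
  refine ⟨?_, hex'⟩
  -- the upper end of the bracket is a genuine fraction
  have hd : d ≠ 0 := by
    rintro rfl
    have hcb := hB.det
    rw [mul_zero, zero_add] at hcb
    have hb1 : b = 1 := Nat.dvd_one.1 (Dvd.intro_left c hcb)
    have hc1 : c = 1 := Nat.dvd_one.1 (Dvd.intro b hcb)
    -- An upper end 1/0 would mean a factor of at least N > 2^D₁, yet some good scaled by it stays
    -- at or below `r i ≤ 2^D₁`.
    have hNa : N ≤ a := by omega
    obtain ⟨i, -, h⟩ := hex'
    have hxa : x = a := by rw [hxdef, hb1]; norm_num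
    have : (N : ℝ) ≤ a := by exact_mod_cast hNa
    nlinarith [hp.1 i, (hr i).2]
  obtain ⟨hxy, hyN⟩ := hB.div_sub_div_le hd hac
  rw [← hxdef] at hxy hyN
  set y : ℝ := (c : ℝ) / d with hydef
  have hy : 1 ≤ y := by linarith
  have hlip : ∀ i, |M.surplus (fun k => min (scaled p y G k) (r k)) i -
      M.surplus (scaled p x G) i| ≤ 4 * μ := fun i => by
    rw [← hp'.surplus_min_eq hm hU hG hr' hr1 i]
    exact abs_surplus_min_scaled_sub_le hD hp.1 hr hx (by linarith)
      ((by positivity : (0 : ℝ) < 2 ^ D₁).trans hN) hyN hνN G i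
  have hfail := exists_of_not_searchCond hm hU hG hp hr' hr1 hy
    (hS c d (Nat.one_le_iff_ne_zero.2 hd) hB.d_le_c) hμ (hB.upper.resolve_left hd)
  -- some surplus changes considerably
  set γ := A / (20 * m) with hγ
  have hγ0 : 0 < γ := by positivity
  have hmγ : m * γ = A / 20 := by rw [hγ]; field_simp
  have hγA : γ ≤ A / 20 := by nlinarith
  have hγμ : 640 * (μ : ℝ) ≤ γ := by
    rw [hγ, le_div_iff₀ (by positivity)]
    linarith
  -- Moving the failure from `y` back to `x` costs 4μ per surplus. Either a surplus of at least A/4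
  -- is now at most 6μ, or a gap of 5γ/2 has shrunk to at most 10μ, so that one of its two ends
  -- moved by γ.
  have hgain : (∃ i ∈ G, γ ≤ M.surplus p i - M.surplus (scaled p x G) i) ∨
      ∃ j, j ∉ G ∧ γ ≤ max (M.surplus (scaled p x G) j) 0 - max (M.surplus p j) 0 := by
    rcases hfail with ⟨i, hi, h⟩ | ⟨i, hi, j, hj, h⟩
    · left
      refine ⟨i, hi, ?_⟩
      have := abs_le.1 (hlip i)
      linarith [hquarter i hi]
    · have h1 := abs_le.1 (hlip i)
      have h2 := abs_le.1 (hlip j)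
      have h3 := gap_le_of_mem_topGoods hm hμ hs₀ hk hi hj
      have h4 : A / (8 * m) = 5 / 2 * γ := by rw [hγ]; field_simp; norm_num
      rw [← hA, h4] at h3
      have h5 := le_max_left (M.surplus (scaled p x G) j) 0
      by_contra! hcon
      linarith [hcon.1 i hi, hcon.2 j hj]
  -- The untested starting factor 1 is excluded: it leaves all surpluses unchanged, whereas one of
  -- them moved by γ > 0.
  have hcond : SearchCond (S a b) μ G := by
    rcases hpass with h | h
    · exfalso
      rw [h, scaled_one] at hgain
      rcases hgain with ⟨i, -, h⟩ | ⟨j, -, h⟩ <;> linarith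
    · exact h
  have hmain := sum_posPart_sq_le (s := M.surplus p) (s' := M.surplus (scaled p x G)) (G := G)
    (η := x - 1) (μ := μ) (γ := γ) (by linarith) hμ'.le hγ0.le
    (by rw [sum_surplus hm hU hp.pos, sum_surplus hm hU hp'.pos]) hne
    (fun i hi => ⟨by linarith [hquarter i hi], hnn i hi, by
      rw [add_sub_cancel]; exact surplus_scaled_le hG hp.pos hx hi⟩)
    (fun j hj => surplus_le_surplus_scaled hG hp.pos hx hj)
    (fun i hi j hj => by
      have h1 : (S a b j : ℝ) ≤ S a b i := by exact_mod_cast (hcond i hi).2 j hj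
      have h2 := abs_le.1 (hSx i)
      have h3 := abs_le.1 (hSx j)
      linarith) hgain
  set Φ := ∑ j, max (M.surplus p j) 0 ^ 2 with hΦ
  have hposA : ∀ j, max (M.surplus p j) 0 ≤ A := fun j => max_le (hmax j) hA0.le
  have hl1 : ∑ j, max (M.surplus p j) 0 ≤ m * A := by
    refine (Finset.sum_le_sum fun j _ => hposA j).trans (le_of_eq ?_)
    simp
  have hΦA : Φ ≤ m * A ^ 2 := by
    refine (Finset.sum_le_sum fun j _ =>
      pow_le_pow_left₀ (le_max_right _ _) (hposA j) 2).trans (le_of_eq ?_)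
    simp
  have hΦ0 : 0 ≤ Φ := Finset.sum_nonneg fun j _ => sq_nonneg _
  -- Chosen so that κ m A² = γ²/2. Half of the gain γ² becomes the relative decrease of Φ ≤ m A²;
  -- the other half pays for the oracle error.
  set κ : ℝ := 1 / (800 * (m : ℝ) ^ 3) with hκ
  have hκ0 : 0 < κ := by positivity
  have hκ1 : κ ≤ 1 / 2 := by
    rw [hκ]
    apply one_div_le_one_div_of_le (by norm_num)
    nlinarith
  have hκm : κ * (m * A ^ 2) = γ ^ 2 / 2 := by
    rw [hκ, hγ]; field_simp; norm_num
  -- After bounding the sum by m A this amounts to 3200 m³ μ ≤ A, the reason for demanding a surplus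
  -- of order m³ μ.
  have herr : 4 * (μ : ℝ) * ∑ j, max (M.surplus p j) 0 ≤ γ ^ 2 / 2 := by
    have h1 : 4 * (μ : ℝ) * ∑ j, max (M.surplus p j) 0 ≤ 4 * μ * (m * A) :=
      mul_le_mul_of_nonneg_left hl1 (by positivity)
    have h2 : 4 * (μ : ℝ) * (m * A) ≤ γ ^ 2 / 2 := by
      have h3 : γ ^ 2 / 2 = A * A / (800 * m ^ 2) := by rw [hγ]; field_simp; norm_num
      rw [h3, le_div_iff₀ (by positivity)]
      nlinarith
    exact h1.trans h2
  have hgoal : ∑ j, max (M.surplus (scaled p x G) j) 0 ^ 2 ≤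
      (1 + 2 * (x - 1) * (1 + (x - 1)) - κ) * Φ := by
    nlinarith [mul_le_mul_of_nonneg_left hΦA hκ0.le]
  refine hgoal.trans (mul_le_mul_of_nonneg_right ?_ hΦ0)
  have := one_add_sub_le_mul_pow (η := x - 1) (by linarith) hκ1
  rwa [add_sub_cancel] at this ⊢

end RoundProgress

end WGS

namespace WGS

open OracleProg

/-! ### Runs of programs -/

namespace OracleProg

variable {Q A α β : Type} (O : Q → A)

@[simp] theorem result_pure (a : α) : (pure a : OracleProg Q A α).result O = a := rfl

@[simp] theorem queries_pure (a : α) : (pure a : OracleProg Q A α).queries O = [] := rfl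

@[simp] theorem time_pure (a : α) : (pure a : OracleProg Q A α).time O = 0 := rfl

@[simp] theorem queries_pay (c : ℕ) : (pay c : OracleProg Q A Unit).queries O = [] := rfl

@[simp] theorem time_pay (c : ℕ) : (pay c : OracleProg Q A Unit).time O = c := rfl

@[simp] theorem result_ask (q : Q) : (ask q : OracleProg Q A A).result O = O q := rfl

@[simp] theorem queries_ask (q : Q) : (ask q : OracleProg Q A A).queries O = [q] := rfl

@[simp] theorem time_ask (q : Q) : (ask q : OracleProg Q A A).time O = 1 := rfl

@[simp] theorem result_bind (x : OracleProg Q A α) (f : α → OracleProg Q A β) :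
    (x >>= f).result O = (f (x.result O)).result O := by
  change (andThen x f).result O = _
  induction x with
  | done a => rfl
  | charge c k ih => exact ih
  | query q k ih => exact ih _

@[simp] theorem queries_bind (x : OracleProg Q A α) (f : α → OracleProg Q A β) :
    (x >>= f).queries O = x.queries O ++ (f (x.result O)).queries O := by
  change (andThen x f).queries O = _
  induction x with
  | done a => rfl
  | charge c k ih => exact ih
  | query q k ih => exact congrArg (q :: ·) (ih _)

@[simp] theorem time_bind (x : OracleProg Q A α) (f : α → OracleProg Q A β) :
    (x >>= f).time O = x.time O + (f (x.result O)).time O := by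
  change (andThen x f).time O = _
  induction x with
  | done a => simp [andThen, time, result]
  | charge c k ih => simp only [andThen, time, result, ih, add_assoc]
  | query q k ih => simp only [andThen, time, result, ih, add_assoc]

/-- The run of `x` asks only questions in `V`, asks at most `k` of them, and takes time at most
`w * k`. -/
def CostLE (V : Q → Prop) (w k : ℝ) (x : OracleProg Q A α) : Prop :=
  (∀ q ∈ x.queries O, V q) ∧ ((x.queries O).length : ℝ) ≤ k ∧ (x.time O : ℝ) ≤ w * k

variable {O} {V : Q → Prop} {w k k' : ℝ}

theorem CostLE.mono {x : OracleProg Q A α} (h : CostLE O V w k x) (hw : 0 ≤ w) (hk : k ≤ k') :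
    CostLE O V w k' x :=
  ⟨h.1, h.2.1.trans hk, h.2.2.trans (mul_le_mul_of_nonneg_left hk hw)⟩

theorem CostLE.bind {x : OracleProg Q A α} {f : α → OracleProg Q A β} (h : CostLE O V w k x)
    (h' : CostLE O V w k' (f (x.result O))) : CostLE O V w (k + k') (x >>= f) := by
  refine ⟨fun q hq => ?_, ?_, ?_⟩
  · rw [queries_bind, List.mem_append] at hq
    exact hq.elim (h.1 q) (h'.1 q)
  · rw [queries_bind, List.length_append]
    push_cast
    exact add_le_add h.2.1 h'.2.1
  · rw [time_bind]
    push_cast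
    rw [mul_add]
    exact add_le_add h.2.2 h'.2.2

theorem costLE_pure (a : α) : CostLE O V w 0 (pure a) := by simp [CostLE]

theorem costLE_pay {c : ℕ} (hk : 0 ≤ k) (hc : c ≤ w * k) : CostLE O V w k (pay c) := by
  simp [CostLE, hc, hk]

end OracleProg

/-! ### The binary search -/

section Search

variable {Q A : Type} {O : Q → A} {V : Q → Prop} {w : ℝ}

theorem bisect_spec {test : ℕ → OracleProg Q A Bool} :
    ∀ (f lo hi : ℕ), lo < hi → hi ≤ lo + f →
      let j := (bisect test f lo hi).result O
      lo ≤ j ∧ j < hi ∧ (j = lo ∨ (test j).result O = true) ∧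
        (j + 1 = hi ∨ (test (j + 1)).result O = false)
  | 0, lo, hi, h1, h2 => by omega
  | f + 1, lo, hi, h1, h2 => by
    unfold bisect
    simp only [result_bind]
    split_ifs with hc
    · simp only [result_pure]
      exact ⟨le_rfl, h1, by simp, Or.inl (by omega)⟩
    · simp only [result_bind]
      split_ifs with hb
      · obtain ⟨h3, h4, h5, h6⟩ := bisect_spec (test := test) f ((lo + hi) / 2) hi (by omega)
          (by omega)
        refine ⟨by omega, h4, ?_, h6⟩
        rcases h5 with h5 | h5
        · right; rw [h5]; exact hb
        · exact Or.inr h5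
      · obtain ⟨h3, h4, h5, h6⟩ := bisect_spec (test := test) f lo ((lo + hi) / 2) (by omega)
          (by omega)
        refine ⟨h3, by omega, h5, ?_⟩
        rcases h6 with h6 | h6
        · right; rw [h6]; simpa using hb
        · exact Or.inr h6

/-- One unit pays for a test and the four operations around it, and each test halves the interval;
the extra unit covers the closing comparison. -/
theorem costLE_bisect (hw : 8 ≤ w) {test : ℕ → OracleProg Q A Bool} {J : ℕ}
    (ht : ∀ j, 1 ≤ j → j ≤ J → CostLE O V (w - 4) 1 (test j)) :
    ∀ (f lo hi e : ℕ), hi ≤ J + 1 → hi ≤ lo + 2 ^ e →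
      CostLE O V w (e + 1) (bisect test f lo hi)
  | 0, lo, hi, e, _, _ => (costLE_pure _).mono (by linarith) (by positivity)
  | f + 1, lo, hi, e, h1, h2 => by
    unfold bisect
    split_ifs with hc
    · refine CostLE.mono (k := 1 + 0) (CostLE.bind (costLE_pay (by norm_num) ?_) (costLE_pure lo))
        (by linarith) ?_
      · push_cast; linarith
      · have : (0 : ℝ) ≤ e := by positivity
        linarith
    · obtain ⟨e, rfl⟩ : ∃ e', e = e' + 1 := by
        refine Nat.exists_eq_succ_of_ne_zero ?_
        rintro rfl
        simp at h2
        omega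
      rw [pow_succ] at h2
      have hrec : CostLE O V w (e + 1) (if (test ((lo + hi) / 2)).result O = true then
          bisect test f ((lo + hi) / 2) hi else bisect test f lo ((lo + hi) / 2)) := by
        split_ifs
        · exact costLE_bisect hw ht f _ _ e h1 (by omega)
        · exact costLE_bisect hw ht f _ _ e (by omega) (by omega)
      obtain ⟨t1, t2, t3⟩ := ht ((lo + hi) / 2) (by omega) (by omega)
      obtain ⟨r1, r2, r3⟩ := hrec
      refine ⟨fun q hq => ?_, ?_, ?_⟩
      · simp only [queries_bind, queries_pay, List.nil_append, List.mem_append] at hq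
        exact hq.elim (t1 q) (r1 q)
      · simp only [queries_bind, queries_pay, List.nil_append, List.length_append]
        push_cast
        linarith
      · simp only [time_bind, time_pay]
        push_cast
        linarith

/-- Doubling ends at some 2^e, and bisection then works on an interval of length at most 2^e. As 2^e
/ 2 is at most the index found, the cost depends on that index and not on `J`. For i = 0 the
truncated quotient 2^0 / 2 is the index 0, which counts as passed without a test. -/
theorem expSearch_spec (hw : 8 ≤ w) {test : ℕ → OracleProg Q A Bool} {J : ℕ}
    (ht : ∀ j, 1 ≤ j → j ≤ J → CostLE O V (w - 4) 1 (test j)) :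
    ∀ (f i : ℕ), J < 2 ^ i * 2 ^ f → (2 ^ i / 2 = 0 ∨ (test (2 ^ i / 2)).result O = true) →
      2 ^ i / 2 ≤ J →
      let x := expSearch test J (f + 1) (2 ^ i)
      let j := x.result O
      j ≤ J ∧ (j = 0 ∨ (test j).result O = true) ∧ (j = J ∨ (test (j + 1)).result O = false) ∧
        ∃ e : ℕ, 2 ^ e / 2 ≤ j ∧ CostLE O V w (2 * e + 2 - i) x := by
  intro f
  induction f with
  | zero =>
    intro i h1 h2 h3
    rw [pow_zero, mul_one] at h1
    unfold expSearch
    simp only [result_bind, if_pos h1]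
    obtain ⟨b1, b2, b3, b4⟩ := bisect_spec (O := O) (test := test) (J + 1) (2 ^ i / 2) (J + 1)
      (by omega) (by omega)
    refine ⟨by omega, ?_, ?_, i, b1, ?_⟩
    · rcases b3 with h | h
      · rw [h]; exact h2
      · exact Or.inr h
    · exact b4.imp_left (by omega)
    · refine ((costLE_pay (k := 1) (by norm_num) ?_).bind
        (costLE_bisect hw ht (J + 1) (2 ^ i / 2) (J + 1) i le_rfl (by omega))).mono
        (by linarith) (by linarith)
      push_cast; linarith
  | succ f ih =>
    intro i h1 h2 h3
    by_cases hJ : J < 2 ^ i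
    · unfold expSearch
      simp only [result_bind, if_pos hJ]
      obtain ⟨b1, b2, b3, b4⟩ := bisect_spec (O := O) (test := test) (J + 1) (2 ^ i / 2) (J + 1)
        (by omega) (by omega)
      refine ⟨by omega, ?_, ?_, i, b1, ?_⟩
      · rcases b3 with h | h
        · rw [h]; exact h2
        · exact Or.inr h
      · exact b4.imp_left (by omega)
      · refine ((costLE_pay (k := 1) (by norm_num) ?_).bind
          (costLE_bisect hw ht (J + 1) (2 ^ i / 2) (J + 1) i le_rfl (by omega))).mono
          (by linarith) (by linarith)
        push_cast; linarith
    · have hpos : 1 ≤ 2 ^ i := Nat.one_le_two_pow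
      obtain ⟨t1, t2, t3⟩ := ht (2 ^ i) hpos (by omega)
      have hstep : ∀ {k : ℝ} {y : OracleProg Q A ℕ}, CostLE O V w k y →
          expSearch test J (f + 1 + 1) (2 ^ i) = (do
            pay 4
            let b ← test (2 ^ i)
            if b then expSearch test J (f + 1) (2 * 2 ^ i)
            else bisect test (2 ^ i) (2 ^ i / 2) (2 ^ i)) →
          (if (test (2 ^ i)).result O = true then expSearch test J (f + 1) (2 * 2 ^ i)
            else bisect test (2 ^ i) (2 ^ i / 2) (2 ^ i)) = y →
          CostLE O V w (k + 1) (expSearch test J (f + 1 + 1) (2 ^ i)) := by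
        intro k y hy he hyb
        obtain ⟨r1, r2, r3⟩ := hy
        subst hyb
        rw [he]
        refine ⟨fun q hq => ?_, ?_, ?_⟩
        · simp only [queries_bind, queries_pay, List.nil_append, List.mem_append] at hq
          exact hq.elim (t1 q) (r1 q)
        · simp only [queries_bind, queries_pay, List.nil_append, List.length_append]
          push_cast
          linarith
        · simp only [time_bind, time_pay]
          push_cast
          linarith
      have he : expSearch test J (f + 1 + 1) (2 ^ i) = (do
            pay 4
            let b ← test (2 ^ i)
            if b then expSearch test J (f + 1) (2 * 2 ^ i)
            else bisect test (2 ^ i) (2 ^ i / 2) (2 ^ i)) := by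
        conv_lhs => unfold expSearch
        rw [if_neg hJ]
      by_cases hb : (test (2 ^ i)).result O = true
      · have h2i : 2 * 2 ^ i = 2 ^ (i + 1) := by rw [pow_succ, mul_comm]
        have hhalf : 2 ^ (i + 1) / 2 = 2 ^ i := by omega
        obtain ⟨r1, r2, r3, e, r4, r5⟩ := ih (i + 1)
          (by rw [pow_succ] at h1 ⊢; linarith) (Or.inr (by rw [hhalf]; exact hb)) (by omega)
        have hres : (expSearch test J (f + 1 + 1) (2 ^ i)).result O =
            (expSearch test J (f + 1) (2 ^ (i + 1))).result O := by
          rw [he]; simp only [result_bind, if_pos hb, h2i]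
        have hc := hstep r5 he (by rw [if_pos hb, h2i])
        simp only [hres]
        refine ⟨r1, r2, r3, e, r4, hc.mono (by linarith) ?_⟩
        push_cast; linarith
      · obtain ⟨b1, b2, b3, b4⟩ := bisect_spec (O := O) (test := test) (2 ^ i) (2 ^ i / 2) (2 ^ i)
          (by omega) (by omega)
        have hres : (expSearch test J (f + 1 + 1) (2 ^ i)).result O =
            (bisect test (2 ^ i) (2 ^ i / 2) (2 ^ i)).result O := by
          rw [he]; simp only [result_bind, if_neg hb]
        have hc := hstep (costLE_bisect hw ht (2 ^ i) (2 ^ i / 2) (2 ^ i) i (by omega) (by omega))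
          he (if_neg hb)
        simp only [hres]
        refine ⟨by omega, ?_, ?_, i, b1, hc.mono (by linarith) (by linarith)⟩
        · rcases b3 with h | h
          · rw [h]; exact h2
          · exact Or.inr h
        · rcases b4 with h | h
          · right; rw [h]; simpa using hb
          · exact Or.inr h

theorem gallop_spec (hw : 8 ≤ w) {test : ℕ → OracleProg Q A Bool} {J : ℕ}
    (ht : ∀ j, 1 ≤ j → j ≤ J → CostLE O V (w - 4) 1 (test j)) :
    let j := (gallop test J).result O
    j ≤ J ∧ (j = 0 ∨ (test j).result O = true) ∧ (j = J ∨ (test (j + 1)).result O = false) ∧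
      CostLE O V w (2 * Real.logb 2 (1 + j) + 4) (gallop test J) := by
  obtain ⟨h1, h2, h3, e, h4, h5⟩ := expSearch_spec hw ht J 0
    (by rw [pow_zero, one_mul]; exact Nat.lt_two_pow_self) (Or.inl (by norm_num)) (by norm_num)
  refine ⟨h1, h2, h3, h5.mono (by linarith) ?_⟩
  set j := (expSearch test J (J + 1) (2 ^ 0)).result O with hj
  have h6 : 2 ^ e ≤ 2 * (1 + j) := by omega
  have h7 : (2 : ℝ) ^ e ≤ 2 * (1 + j) := by exact_mod_cast h6
  have h8 : (e : ℝ) ≤ 1 + Real.logb 2 (1 + j) := by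
    have := Real.logb_le_logb_of_le (b := 2) (by norm_num) (by positivity) h7
    rwa [Real.logb_pow, Real.logb_self_eq_one (by norm_num), mul_one,
      Real.logb_mul (by norm_num) (by positivity), Real.logb_self_eq_one (by norm_num)] at this
  have : (gallop test J).result O = j := rfl
  rw [this]
  push_cast
  linarith

theorem costLE_pay_sixteenth (hw : 16 ≤ w) (c : ℕ) :
    CostLE O V w (c / 16) (pay c : OracleProg Q A Unit) := by
  refine costLE_pay (by positivity) ?_
  have : (0 : ℝ) ≤ c := by positivity
  nlinarith

theorem two_mul_logb_sub_ge {c c' u v : ℝ} (hc : 0 < c) (hu : 0 < u) (hv : 0 < v)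
    (h1 : c * u ≤ c') (h2 : c * v ≤ c') :
    Real.logb 2 u + Real.logb 2 v ≤ 2 * (Real.logb 2 c' - Real.logb 2 c) := by
  have e1 := Real.logb_le_logb_of_le (b := 2) (by norm_num) (by positivity) h1
  have e2 := Real.logb_le_logb_of_le (b := 2) (by norm_num) (by positivity) h2
  rw [Real.logb_mul hc.ne' hu.ne'] at e1
  rw [Real.logb_mul hc.ne' hv.ne'] at e2
  linarith

/-- The numerator `c` of the upper end measures progress. Moving both ends costs 2 log₂(1 + j) + 2
log₂(1 + l) + 9 units, while `c` grows by factors of at least 1 + j, 1 + l and 2; so 13 (log₂ c' -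
log₂ c) pays for it. A final move of the lower end alone adds at most 2Λ + 5. The disjunction on the
mediant guarantees that the moved lower numerator is at least `c`, which the factor 1 + l requires.
-/
theorem fracSearch_spec (hw : 16 ≤ w) {test : ℕ → ℕ → OracleProg Q A Bool} {N : ℕ}
    (ht : ∀ a b, 1 ≤ b → b ≤ a → a ≤ N → CostLE O V (w - 9) 1 (test a b)) :
    ∀ (f a b c d : ℕ), IsBracket N (fun a b => (test a b).result O = true) a b c d →
      c ≤ max N 1 → N < f + c →
      (c ≤ a ∨ N < a + c ∨ (test (a + c) (b + d)).result O = true) →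
      let x := fracSearch test N f a b c d
      (∃ c' d', IsBracket N (fun a b => (test a b).result O = true)
        (x.result O).1 (x.result O).2 c' d' ∧ N < (x.result O).1 + c') ∧
      CostLE O V w (15 * Real.logb 2 (max N 1 : ℕ) + 5 - 13 * Real.logb 2 c) x := by
  have hmax : (1 : ℝ) ≤ (max N 1 : ℕ) := by exact_mod_cast le_max_right N 1
  have hmaxlog : 0 ≤ Real.logb 2 (max N 1 : ℕ) := Real.logb_nonneg (by norm_num) hmax
  set Λ := Real.logb 2 ((max N 1 : ℕ) : ℝ) with hΛ
  have hclog : ∀ c : ℕ, 1 ≤ c → c ≤ max N 1 →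
      Real.logb 2 c ≤ Λ := fun c h1 h2 =>
    Real.logb_le_logb_of_le (by norm_num) (by exact_mod_cast h1) (by exact_mod_cast h2)
  intro f
  induction f with
  | zero =>
    intro a b c d hB hc hf _
    have h1 := hclog c hB.one_le_c hc
    exact ⟨⟨c, d, hB, by have := hB.one_le_c; simp [fracSearch]; omega⟩,
      (costLE_pure _).mono (by linarith) (by linarith)⟩
  | succ f ih =>
    intro a b c d hB hc hf hmed
    have hb1 := hB.one_le_b
    have hba := hB.b_le_a
    have hc1 := hB.one_le_c
    have hdc := hB.d_le_c
    have hclog' := hclog c hc1 hc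
    by_cases hac : N < a + c
    · have hx : fracSearch test N (f + 1) a b c d = (do pay 2; pure (a, b)) := by
        rw [fracSearch, if_pos hac]
      rw [hx]
      refine ⟨⟨c, d, hB, hac⟩, ?_⟩
      refine CostLE.mono (CostLE.bind (costLE_pay_sixteenth hw 2) (costLE_pure (a, b)))
        (by linarith) ?_
      push_cast
      linarith
    -- moving the lower end
    set t₁ : ℕ → OracleProg Q A Bool := fun j => do pay 4; test (a + j * c) (b + j * d) with ht₁
    have hJ : ∀ j, j ≤ (N - a) / c → a + j * c ≤ N := fun j hj => by
      have := (Nat.le_div_iff_mul_le hc1).1 hj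
      omega
    have hbj : ∀ j, 1 ≤ b + j * d ∧ b + j * d ≤ a + j * c := fun j =>
      ⟨by omega, add_le_add hba (Nat.mul_le_mul_left j hdc)⟩
    have hcost₁ : ∀ j, 1 ≤ j → j ≤ (N - a) / c → CostLE O V (w - 4) 1 (t₁ j) := fun j _ hj => by
      obtain ⟨q1, q2, q3⟩ := ht _ _ (hbj j).1 (hbj j).2 (hJ j hj)
      refine ⟨?_, ?_, ?_⟩
      · simpa [ht₁] using q1
      · simpa [ht₁] using q2
      · simp only [ht₁, time_bind, time_pay]
        push_cast
        linarith
    obtain ⟨j1, j2, j3, j4⟩ := gallop_spec (by linarith) hcost₁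
    set j := (gallop t₁ ((N - a) / c)).result O with hj
    have hres₁ : ∀ j, (t₁ j).result O = (test (a + j * c) (b + j * d)).result O := fun j => rfl
    rw [hres₁] at j2 j3
    set a' := a + j * c with ha'
    set b' := b + j * d with hb'
    have ha'N : a' ≤ N := hJ j j1
    have hB₁ : IsBracket N (fun a b => (test a b).result O = true) a' b' c d := by
      refine ⟨(hbj j).1, (hbj j).2, hc1, hdc, ?_, ?_, hB.upper, ha'N.trans (le_max_left _ _)⟩
      · have := hB.det
        rw [ha', hb']
        linear_combination this
      · rcases j2 with h | h
        · simpa [ha', hb', h] using hB.lower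
        · exact Or.inr h
    have hjN : Real.logb 2 (1 + j) ≤ Λ := by
      have h1 : 1 + j ≤ max N 1 := by
        have : j * 1 ≤ j * c := Nat.mul_le_mul_left j hc1
        omega
      exact_mod_cast hclog (1 + j) (by omega) h1
    -- A mediant that is in range and passes would have moved the lower end, so only the first
    -- alternative of `hmed` survives.
    have hj0 : j = 0 → c ≤ a := fun h0 => by
      rcases hmed with h | h | h
      · exact h
      · exact absurd h hac
      · rw [h0] at j3
        rcases j3 with h' | h'
        · have := (Nat.div_eq_zero_iff_lt hc1).1 h'.symm
          omega
        · simp only [zero_add, one_mul] at h'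
          rw [h] at h'
          exact absurd h' (by simp)
    have hca' : c ≤ a' := by
      rcases Nat.eq_zero_or_pos j with h | h
      · exact (hj0 h).trans (by omega)
      · have : 1 * c ≤ j * c := Nat.mul_le_mul_right c h
        omega
    have hx : fracSearch test N (f + 1) a b c d = (do
        pay 2
        pay 2
        let j ← gallop t₁ ((N - a) / c)
        pay 6
        if N < a + j * c + c then pure (a + j * c, b + j * d)
        else do
          pay 2
          let l ← gallop
            (fun l => do
              pay 5
              let t ← test (c + l * (a + j * c)) (d + l * (b + j * d))
              pure (!t))
            ((N - c) / (a + j * c))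
          pay 4
          fracSearch test N f (a + j * c) (b + j * d) (c + l * (a + j * c))
            (d + l * (b + j * d))) := by
      rw [fracSearch, if_neg hac]
    rw [hx]
    by_cases hac' : N < a' + c
    · refine ⟨?_, ?_⟩
      · simp only [result_bind]
        rw [← hj, if_pos hac']
        exact ⟨c, d, hB₁, hac'⟩
      · refine CostLE.mono (CostLE.bind (costLE_pay_sixteenth hw 2)
          (CostLE.bind (costLE_pay_sixteenth hw 2) (CostLE.bind j4
            (CostLE.bind (costLE_pay_sixteenth hw 6) (k' := 0) ?_)))) (by linarith) ?_
        · rw [← hj, if_pos hac']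
          exact costLE_pure (a', b')
        · push_cast
          linarith
    -- moving the upper end
    set t₂ : ℕ → OracleProg Q A Bool := fun l => do
      pay 5
      let t ← test (c + l * a') (d + l * b')
      pure (!t) with ht₂
    have ha'1 : 1 ≤ a' := by omega
    have hJ₂ : ∀ l, l ≤ (N - c) / a' → c + l * a' ≤ N := fun l hl => by
      have := (Nat.le_div_iff_mul_le ha'1).1 hl
      omega
    have hdl : ∀ l, d + l * b' ≤ c + l * a' := fun l =>
      add_le_add hdc (Nat.mul_le_mul_left l hB₁.b_le_a)
    have hdl1 : ∀ l, 1 ≤ l → 1 ≤ d + l * b' := fun l hl => by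
      have := Nat.mul_le_mul hl hB₁.one_le_b
      omega
    have hcost₂ : ∀ l, 1 ≤ l → l ≤ (N - c) / a' → CostLE O V (w - 4) 1 (t₂ l) := fun l h1 hl => by
      obtain ⟨q1, q2, q3⟩ := ht _ _ (hdl1 l h1) (hdl l) (hJ₂ l hl)
      refine ⟨?_, ?_, ?_⟩
      · simpa [ht₂] using q1
      · simpa [ht₂] using q2
      · simp only [ht₂, time_bind, time_pay, time_pure]
        push_cast
        linarith
    obtain ⟨l1, l2, l3, l4⟩ := gallop_spec (by linarith) hcost₂
    set l := (gallop t₂ ((N - c) / a')).result O with hl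
    have hres₂ : ∀ l, (t₂ l).result O = !(test (c + l * a') (d + l * b')).result O := fun l => by
      simp only [ht₂, result_bind, result_pure]
    rw [hres₂, Bool.not_eq_true'] at l2
    rw [hres₂, Bool.not_eq_false'] at l3
    -- The mediant of the current bracket is the fraction with index j + 1 of the previous gallop.
    -- It is in range and failed there, so the upper end moves.
    have hl1 : 1 ≤ l := by
      rw [Nat.one_le_iff_ne_zero]
      intro h0
      have hjt : (test (a + (j + 1) * c) (b + (j + 1) * d)).result O = false := by
        refine j3.resolve_left fun h => hac' ?_
        have := Nat.lt_mul_div_succ (N - a) hc1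
        rw [← h] at this
        rw [ha']
        have e : c * (j + 1) = j * c + c := by ring
        omega
      rw [h0] at l3
      rcases l3 with h | h
      · have := (Nat.div_eq_zero_iff_lt ha'1).1 h.symm
        omega
      · have e1 : c + (0 + 1) * a' = a + (j + 1) * c := by rw [ha']; ring
        have e2 : d + (0 + 1) * b' = b + (j + 1) * d := by rw [hb']; ring
        rw [e1, e2, hjt] at h
        exact absurd h (by simp)
    set c' := c + l * a' with hc'
    set d' := d + l * b' with hd'
    have hc'N : c' ≤ N := hJ₂ l l1
    have hla' : a' ≤ l * a' := Nat.le_mul_of_pos_left a' hl1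
    have hB₂ : IsBracket N (fun a b => (test a b).result O = true) a' b' c' d' := by
      refine ⟨hB₁.one_le_b, hB₁.b_le_a, by omega, hdl l, ?_, hB₁.lower, ?_, hB₁.a_le⟩
      · have := hB₁.det
        rw [hc', hd']
        linear_combination this
      · right
        rcases l2 with h | h
        · omega
        · simp [h]
    -- Maximality of `l` is the disjunction required for the next call: the new mediant is out of
    -- range or passes.
    obtain ⟨r1, r2⟩ := ih a' b' c' d' hB₂ (hc'N.trans (le_max_left _ _)) (by omega) (by
      right
      rcases l3 with h | h
      · left
        have := Nat.lt_mul_div_succ (N - c) ha'1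
        rw [← h] at this
        have e : a' * (l + 1) = l * a' + a' := by ring
        omega
      · right
        have e1 : c + (l + 1) * a' = a' + c' := by rw [hc']; ring
        have e2 : d + (l + 1) * b' = b' + d' := by rw [hd']; ring
        rwa [e1, e2] at h)
    refine ⟨?_, ?_⟩
    · simp only [result_bind]
      rw [← hj, if_neg hac']
      simp only [result_bind]
      exact r1
    · refine CostLE.mono (CostLE.bind (costLE_pay_sixteenth hw 2)
        (CostLE.bind (costLE_pay_sixteenth hw 2) (CostLE.bind j4
          (CostLE.bind (costLE_pay_sixteenth hw 6)
            (k' := ((2 : ℕ) : ℝ) / 16 + ((2 * Real.logb 2 (1 + l) + 4) + (((4 : ℕ) : ℝ) / 16 +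
              (15 * Λ + 5 - 13 * Real.logb 2 c')))) ?_)))) (by linarith) ?_
      · rw [← hj, if_neg hac']
        exact CostLE.bind (costLE_pay_sixteenth hw 2) (CostLE.bind l4
          (CostLE.bind (costLE_pay_sixteenth hw 4) r2))
      · have hc0 : (0 : ℝ) < c := by exact_mod_cast hc1
        have e1 : c * (1 + j) ≤ c' := by
          have h1 : c * (1 + j) = c + j * c := by ring
          omega
        have e2 : c * (1 + l) ≤ c' := by
          have h1 : c * (1 + l) = c + l * c := by ring
          have h2 : l * c ≤ l * a' := Nat.mul_le_mul_left l hca'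
          omega
        have e3 : c * 2 ≤ c' := by omega
        -- `g1` pays for the logarithms with coefficient 4. `g2`, the doubling of `c`, pays for the
        -- 9 fixed units: twice 4 for the gallops and 16/16 for the charges.
        have g1 := two_mul_logb_sub_ge (c' := c') hc0 (by positivity : (0 : ℝ) < 1 + j)
          (by positivity : (0 : ℝ) < 1 + l) (by exact_mod_cast e1) (by exact_mod_cast e2)
        have g2 := two_mul_logb_sub_ge (c' := c') hc0 (by norm_num : (0 : ℝ) < 2)
          (by norm_num : (0 : ℝ) < 2) (by exact_mod_cast e3) (by exact_mod_cast e3)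
        rw [Real.logb_self_eq_one (by norm_num)] at g2
        push_cast
        linarith

end Search

end WGS

namespace WGS

open OracleProg ExchangeMarket

/-! ### Rounds and their cost -/

section Rounds

variable {m : ℕ} {O : (Fin m → ℚ) × ℚ → (Fin m → ℚ)}

/-- `q` is a quotient of positive integers that are at most `K`. -/
def IsQuotLE (K : ℕ) (q : ℚ) : Prop :=
  ∃ A B : ℕ, 1 ≤ A ∧ A ≤ K ∧ 1 ≤ B ∧ B ≤ K ∧ q = (A : ℚ) / B

theorem IsQuotLE.mono {K K' : ℕ} {q : ℚ} (h : IsQuotLE K q) (hK : K ≤ K') : IsQuotLE K' q := by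
  obtain ⟨A, B, h1, h2, h3, h4, h5⟩ := h
  exact ⟨A, B, h1, h2.trans hK, h3, h4.trans hK, h5⟩

theorem IsQuotLE.mul {K K' : ℕ} {q q' : ℚ} (h : IsQuotLE K q) (h' : IsQuotLE K' q') :
    IsQuotLE (K * K') (q * q') := by
  obtain ⟨A, B, h1, h2, h3, h4, rfl⟩ := h
  obtain ⟨A', B', h1', h2', h3', h4', rfl⟩ := h'
  refine ⟨A * A', B * B', Nat.mul_pos h1 h1', Nat.mul_le_mul h2 h2', Nat.mul_pos h3 h3',
    Nat.mul_le_mul h4 h4', ?_⟩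
  push_cast
  rw [div_mul_div_comm]

theorem IsQuotLE.pos {K : ℕ} {q : ℚ} (h : IsQuotLE K q) : 0 < q := by
  obtain ⟨A, B, h1, -, h3, -, rfl⟩ := h
  exact div_pos (by exact_mod_cast h1) (by exact_mod_cast h3)

theorem IsQuotLE.num_le {K : ℕ} {q : ℚ} (h : IsQuotLE K q) : q.num.natAbs ≤ K := by
  obtain ⟨A, B, h1, h2, h3, -, rfl⟩ := h
  have hd : ((A : ℚ) / B).num ∣ (A : ℤ) := by
    have := Rat.num_dvd (A : ℤ) (b := (B : ℤ)) (by positivity)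
    simpa [Rat.divInt_eq_div] using this
  have := Int.natAbs_dvd_natAbs.2 hd
  exact (Nat.le_of_dvd h1 (by simpa using this)).trans h2

theorem IsQuotLE.den_le {K : ℕ} {q : ℚ} (h : IsQuotLE K q) : q.den ≤ K := by
  obtain ⟨A, B, h1, -, h3, h4, rfl⟩ := h
  have hd : ((((A : ℚ) / B).den : ℕ) : ℤ) ∣ (B : ℤ) := by
    have := Rat.den_dvd (A : ℤ) (B : ℤ)
    simpa [Rat.divInt_eq_div] using this
  exact (Nat.le_of_dvd h3 (by exact_mod_cast hd)).trans h4

theorem size_le_logb {k K T : ℕ} (hK : 1 ≤ K) (h : k ≤ K ^ T) :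
    (k.size : ℝ) ≤ T * Real.logb 2 K + 1 := by
  rcases Nat.eq_zero_or_pos k with rfl | hk
  · have : 0 ≤ Real.logb 2 K := Real.logb_nonneg (by norm_num) (by exact_mod_cast hK)
    rw [Nat.size_zero, Nat.cast_zero]
    positivity
  · have h1 : 2 ^ (k.size - 1) ≤ k := by
      rw [← Nat.lt_size]
      have := Nat.size_pos.2 hk
      omega
    have h2 : (2 : ℝ) ^ (k.size - 1) ≤ (K : ℝ) ^ T := by exact_mod_cast h1.trans h
    have h3 := Real.logb_le_logb_of_le (b := 2) (by norm_num) (by positivity) h2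
    rw [Real.logb_pow, Real.logb_pow, Real.logb_self_eq_one (by norm_num), mul_one,
      Nat.cast_sub (Nat.size_pos.2 hk)] at h3
    push_cast at h3
    linarith

theorem isQuotLE_updatePrices {K N : ℕ} {p : Fin m → ℚ} (hp : ∀ j, IsQuotLE K (p j))
    {a b : ℕ} (hb : 1 ≤ b) (hba : b ≤ a) (ha : a ≤ max N 1) (G : Finset (Fin m)) (j : Fin m) :
    IsQuotLE (K * max N 1) (updatePrices p ((a : ℚ) / b) G j) := by
  unfold updatePrices
  split_ifs
  · rw [mul_comm K]
    exact IsQuotLE.mul ⟨a, b, hb.trans hba, ha, hb, hba.trans ha, rfl⟩ (hp j)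
  · exact (hp j).mono (Nat.le_mul_of_pos_right K (by omega))

/-- A round multiplies the prices of the top goods by the lower end of a final bracket. -/
theorem round_spec (O : (Fin m → ℚ) × ℚ → (Fin m → ℚ)) (μ : ℚ) (N : ℕ) (p : Fin m → ℚ) {K : ℕ}
    (hp : ∀ j, IsQuotLE K (p j)) :
    (∃ a b c d : ℕ, IsBracket N (fun a b => SearchCond
        (O (updatePrices p ((a : ℚ) / b) (topGoods (O (p, μ)) μ), μ)) μ (topGoods (O (p, μ)) μ))
        a b c d ∧ N < a + c ∧
      (round μ N p).result O = updatePrices p ((a : ℚ) / b) (topGoods (O (p, μ)) μ)) ∧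
    (∀ q ∈ (round μ N p).queries O, ∀ j, IsQuotLE (K * max N 1) (q.1 j)) ∧
    (((round μ N p).queries O).length : ℝ) ≤ 15 * Real.logb 2 (max N 1 : ℕ) + 6 ∧
    ((round μ N p).time O : ℝ) ≤
      (3 * m + 16) * (15 * Real.logb 2 (max N 1 : ℕ) + 5) + m ^ 2 + 5 * m + 2 := by
  set G := topGoods (O (p, μ)) μ with hG
  set test : ℕ → ℕ → MarketProg m Bool := fun a b => do
      pay (1 + m)
      let s' ← ask (updatePrices p ((a : ℚ) / (b : ℚ)) G, μ)
      pay (2 * m)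
      pure (decide (SearchCond s' μ G)) with htest
  have hres : ∀ a b, ((test a b).result O = true) =
      SearchCond (O (updatePrices p ((a : ℚ) / b) G, μ)) μ G := fun a b =>
    propext decide_eq_true_iff
  -- One test takes 3m + 2 steps, within w - 9 for w = 3m + 16. The initial bracket is 1/1, 1/0, for
  -- which log₂ c = 0.
  obtain ⟨⟨c, d, h1, h2⟩, h3, h4, h5⟩ := fracSearch_spec (O := O)
    (V := fun q => ∀ j, IsQuotLE (K * max N 1) (q.1 j)) (w := 3 * m + 16)
    (test := test) (N := N) (by have : (0 : ℝ) ≤ m := by positivity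
                                linarith)
    (fun a b hb hba haN => by
      refine ⟨?_, ?_, ?_⟩
      · simp only [htest, queries_bind, queries_pay, queries_ask, queries_pure, List.nil_append,
          List.append_nil, List.mem_singleton, forall_eq]
        exact isQuotLE_updatePrices hp hb hba (haN.trans (le_max_left _ _)) G
      · simp [htest]
      · simp only [htest, time_bind, time_pay, time_ask, time_pure]
        push_cast
        linarith)
    N 1 1 1 0
    ⟨le_rfl, le_rfl, le_rfl, by omega, rfl, Or.inl ⟨rfl, rfl⟩, Or.inl rfl, le_max_right _ _⟩
    (le_max_right _ _) (by omega) (Or.inl le_rfl)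
  simp only [hres] at h1
  have hround : round μ N p = (do
      let s ← ask (p, μ)
      pay (m ^ 2 + 4 * m)
      let x ← fracSearch (fun a b => do
        pay (1 + m)
        let s' ← ask (updatePrices p ((a : ℚ) / (b : ℚ)) (topGoods s μ), μ)
        pay (2 * m)
        pure (decide (SearchCond s' μ (topGoods s μ)))) N N 1 1 1 0
      pay (1 + m)
      pure (updatePrices p ((x.1 : ℚ) / (x.2 : ℚ)) (topGoods s μ))) := rfl
  have hq : (round μ N p).queries O = (p, μ) :: (fracSearch test N N 1 1 1 0).queries O := by
    rw [hround]
    simp only [queries_bind, queries_pay, queries_ask, queries_pure, List.nil_append,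
      List.append_nil, result_ask, List.singleton_append]
    rfl
  have htime : (round μ N p).time O =
      1 + (m ^ 2 + 4 * m + ((fracSearch test N N 1 1 1 0).time O + (1 + m))) := by
    rw [hround]
    simp only [time_bind, time_pay, time_ask, time_pure, result_ask, add_zero]
    rfl
  have hresult : (round μ N p).result O = updatePrices p
      ((((fracSearch test N N 1 1 1 0).result O).1 : ℚ) /
        ((fracSearch test N N 1 1 1 0).result O).2) G := by
    rw [hround]
    simp only [result_bind, result_ask, result_pure]
    rfl
  simp only [Nat.cast_one, Real.logb_one, mul_zero, sub_zero] at h4 h5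
  refine ⟨⟨_, _, c, d, h1, h2, hresult⟩, ?_, ?_, ?_⟩
  · rw [hq]
    intro q hq' j
    rcases List.mem_cons.1 hq' with rfl | hq'
    · exact (hp j).mono (Nat.le_mul_of_pos_right K (by omega))
    · exact h3 q hq' j
  · rw [hq, List.length_cons]
    push_cast at h4 ⊢
    linarith
  · rw [htime]
    push_cast at h5 ⊢
    linarith

theorem roundsUntil_succ (μ : ℚ) (N : ℕ) (δ : ℚ) (T : ℕ) (p : Fin m → ℚ) :
    roundsUntil μ N δ (T + 1) p = (do
      let p' ← round μ N p
      let s ← ask (p', μ)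
      pay (2 * m + 1)
      if ∑ i, s i ^ 2 < δ then pure (some p') else roundsUntil μ N δ T p') := rfl

/-- Here `t` counts the rounds already done: each contributes one factor `max N 1` to the bound on
numerators and denominators. The stopping test adds one query per round. -/
theorem roundsUntil_cost (O : (Fin m → ℚ) × ℚ → (Fin m → ℚ)) (μ : ℚ) (N : ℕ) (δ : ℚ) :
    ∀ (T : ℕ) (p : Fin m → ℚ) (t : ℕ), (∀ j, IsQuotLE (max N 1 ^ t) (p j)) →
      (∀ q ∈ (roundsUntil μ N δ T p).queries O, ∀ j, IsQuotLE (max N 1 ^ (t + T)) (q.1 j)) ∧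
      (((roundsUntil μ N δ T p).queries O).length : ℝ) ≤
        T * (15 * Real.logb 2 (max N 1 : ℕ) + 7) ∧
      ((roundsUntil μ N δ T p).time O : ℝ) ≤
        T * ((3 * m + 16) * (15 * Real.logb 2 (max N 1 : ℕ) + 5) + m ^ 2 + 7 * m + 4) := by
  have hΛ : 0 ≤ Real.logb 2 (max N 1 : ℕ) :=
    Real.logb_nonneg (by norm_num) (by exact_mod_cast le_max_right N 1)
  intro T
  induction T with
  | zero =>
    intro p t _
    simp [roundsUntil]
  | succ T ih =>
    intro p t hp
    obtain ⟨⟨a, b, c, d, hB, -, hres⟩, h1, h2, h3⟩ := round_spec O μ N p hp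
    set Λ := Real.logb 2 ((max N 1 : ℕ) : ℝ) with hΛdef
    set p' := (round μ N p).result O with hp'
    have hp'q : ∀ j, IsQuotLE (max N 1 ^ (t + 1)) (p' j) := fun j => by
      rw [hres, pow_succ]
      exact isQuotLE_updatePrices hp hB.one_le_b hB.b_le_a hB.a_le _ j
    have hmono : ∀ {e q}, e ≤ t + (T + 1) → IsQuotLE (max N 1 ^ e) q →
        IsQuotLE (max N 1 ^ (t + (T + 1))) q := fun he hq =>
      hq.mono (Nat.pow_le_pow_right (by omega) he)
    obtain ⟨i1, i2, i3⟩ := ih p' (t + 1) hp'q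
    set Y : MarketProg m (Option (Fin m → ℚ)) :=
      if ∑ i, O (p', μ) i ^ 2 < δ then pure (some p') else roundsUntil μ N δ T p' with hY
    have hY1 : ∀ q ∈ Y.queries O, ∀ j, IsQuotLE (max N 1 ^ (t + (T + 1))) (q.1 j) := by
      intro q hq j
      rw [hY] at hq
      split_ifs at hq
      · simp at hq
      · exact hmono (by omega) (i1 q hq j)
    have hY2 : ((Y.queries O).length : ℝ) ≤ T * (15 * Λ + 7) := by
      rw [hY]
      split_ifs
      · rw [queries_pure, List.length_nil, Nat.cast_zero]; positivity
      · exact i2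
    have hY3 : (Y.time O : ℝ) ≤ T * ((3 * m + 16) * (15 * Λ + 5) + m ^ 2 + 7 * m + 4) := by
      rw [hY]
      split_ifs
      · rw [time_pure, Nat.cast_zero]; positivity
      · exact i3
    have hq : (roundsUntil μ N δ (T + 1) p).queries O =
        (round μ N p).queries O ++ (p', μ) :: Y.queries O := by
      rw [roundsUntil_succ]
      simp only [queries_bind, queries_pay, queries_ask, result_ask, List.nil_append,
        List.singleton_append]
      rfl
    have htime : (roundsUntil μ N δ (T + 1) p).time O =
        (round μ N p).time O + (1 + (2 * m + 1 + Y.time O)) := by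
      rw [roundsUntil_succ]
      simp only [time_bind, time_pay, time_ask, result_ask]
      rfl
    refine ⟨?_, ?_, ?_⟩
    · rw [hq]
      intro q hq' j
      rcases List.mem_append.1 hq' with h | h
      · refine hmono (e := t + 1) (by omega) ?_
        rw [pow_succ]
        exact h1 q h j
      · rcases List.mem_cons.1 h with rfl | h
        · exact hmono (by omega) (hp'q j)
        · exact hY1 q h j
    · rw [hq, List.length_append, List.length_cons]
      push_cast
      linarith
    · rw [htime]
      push_cast
      linarith

/-- If every round either reaches the stopping criterion or decreases a bounded potential by `κ`,
then the rounds stop in time. -/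
theorem exists_roundsUntil_eq_some {μ : ℚ} {N : ℕ} {δ : ℚ} {P : (Fin m → ℚ) → Prop}
    {F : (Fin m → ℚ) → ℝ} {F₀ κ : ℝ} (hκ : 0 < κ)
    (hstep : ∀ p, P p → P ((round μ N p).result O) ∧
      (∑ i, O ((round μ N p).result O, μ) i ^ 2 < δ ∨
        (F ((round μ N p).result O) ≤ F p - κ ∧ F₀ ≤ F ((round μ N p).result O)))) :
    ∀ (T : ℕ) (p : Fin m → ℚ), P p → 1 ≤ T → F p - F₀ < κ * T →
      ∃ p', (roundsUntil μ N δ T p).result O = some p' ∧ P p' ∧ ∑ i, O (p', μ) i ^ 2 < δ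
  | 0, _, _, hT, _ => by omega
  | T + 1, p, hp, _, hF => by
    obtain ⟨h1, h2⟩ := hstep p hp
    have hres : (roundsUntil μ N δ (T + 1) p).result O =
        (if ∑ i, O ((round μ N p).result O, μ) i ^ 2 < δ then pure (some ((round μ N p).result O))
          else roundsUntil μ N δ T ((round μ N p).result O) :
            MarketProg m (Option (Fin m → ℚ))).result O := by
      rw [roundsUntil_succ]
      simp only [result_bind]
      rfl
    rw [hres]
    by_cases hfin : ∑ i, O ((round μ N p).result O, μ) i ^ 2 < δ
    · rw [if_pos hfin]
      exact ⟨_, rfl, h1, hfin⟩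
    · rw [if_neg hfin]
      obtain ⟨h3, h4⟩ := h2.resolve_left hfin
      push_cast at hF
      refine exists_roundsUntil_eq_some hκ hstep T _ h1 ?_ (by linarith)
      -- With no round left the potential would already be below `F₀`, against `h4`.
      rw [Nat.one_le_iff_ne_zero]
      rintro rfl
      simp at hF
      linarith

end Rounds

end WGS

namespace WGS

open OracleProg ExchangeMarket

/-! ### Termination -/

section Termination

variable {n m : ℕ} {M : ExchangeMarket n m}

/-- Since the surpluses sum to zero, their positive parts bound every |s_j|. Each oracle value is
then below ε/(2m), and m such squares stay below the stopping threshold. -/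
theorem sum_sq_lt_of_sum_posPart_le (hm : 1 ≤ m) {s : Fin m → ℝ} {s₁ : Fin m → ℚ} {μ ε : ℚ}
    (hs : Approximates s₁ s μ) (hsum : ∑ j, s j = 0)
    (hpos : ∑ j, max (s j) 0 ≤ (ε : ℝ) / (4 * m)) (hμ : (μ : ℝ) < ε / (4 * m)) :
    ∑ i, s₁ i ^ 2 < ε ^ 2 / (4 * m) := by
  have hm' : (0 : ℝ) < m := by exact_mod_cast hm
  have hterm : ∀ i, (s₁ i : ℝ) ^ 2 < (ε : ℝ) ^ 2 / (4 * m ^ 2) := fun i => by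
    have h1 : |(s₁ i : ℝ)| < ε / (2 * m) := by
      have h2 := abs_sub_abs_le_abs_sub (s₁ i : ℝ) (s i)
      have h3 := hs i
      have h4 := abs_le_sum_posPart hsum i
      have h5 : (ε : ℝ) / (2 * m) = ε / (4 * m) + ε / (4 * m) := by field_simp; ring
      linarith
    have h6 := pow_lt_pow_left₀ h1 (abs_nonneg _) two_ne_zero
    rw [sq_abs] at h6
    refine h6.trans_eq ?_
    field_simp
    norm_num
  have : Nonempty (Fin m) := ⟨⟨0, hm⟩⟩
  have hlt : ∑ i, (s₁ i : ℝ) ^ 2 < ∑ _i : Fin m, (ε : ℝ) ^ 2 / (4 * m ^ 2) :=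
    Finset.sum_lt_sum_of_nonempty Finset.univ_nonempty fun i _ => hterm i
  have heq : ∑ _i : Fin m, (ε : ℝ) ^ 2 / (4 * m ^ 2) = (ε : ℝ) ^ 2 / (4 * m) := by
    rw [Finset.sum_const, Finset.card_univ, Fintype.card_fin, nsmul_eq_mul]
    field_simp
  rw [heq] at hlt
  exact_mod_cast hlt

/-- A small approximate surplus gives an approximate equilibrium. -/
theorem exists_isApproxEquilibrium (hm : 1 ≤ m) (hU : M.UniqueDemands) {p : Fin m → ℝ}
    (hp : M.Admissible p) {s₁ : Fin m → ℚ} {μ ε : ℚ} (hε : 0 < ε)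
    (hs : Approximates s₁ (M.surplus p) μ) (hμ : 2 * μ ≤ ε)
    (hfin : ∑ i, s₁ i ^ 2 < ε ^ 2 / (4 * m)) :
    ∃ x, M.IsApproxEquilibrium (1 + (ε : ℝ)) x p := by
  refine ⟨fun i => M.demand i p, fun j => (hp.pos j).le, isDemand_demand hU hp.pos, fun j => ?_⟩
  rw [M.endow_total, mul_one]
  change M.aggDemand p j ≤ 1 + ε
  have h1 : s₁ j ^ 2 < (ε / 2) ^ 2 := by
    have h2 : s₁ j ^ 2 ≤ ∑ i, s₁ i ^ 2 :=
      Finset.single_le_sum (f := fun i => s₁ i ^ 2) (fun i _ => sq_nonneg _) (Finset.mem_univ j)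
    have h3 : ε ^ 2 / (4 * m) ≤ ε ^ 2 / 4 := by
      have : (1 : ℚ) ≤ m := by exact_mod_cast hm
      apply div_le_div_of_nonneg_left (sq_nonneg ε) (by norm_num) (by linarith)
    calc s₁ j ^ 2 < ε ^ 2 / 4 := by linarith
      _ = (ε / 2) ^ 2 := by ring
  have h4 : s₁ j < ε / 2 := lt_of_pow_lt_pow_left₀ 2 (by linarith) h1
  have h5 : (s₁ j : ℝ) < ε / 2 := by
    have : ((s₁ j : ℚ) : ℝ) < ((ε / 2 : ℚ) : ℝ) := by exact_mod_cast h4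
    simpa using this
  have h6 := abs_le.1 (hs j)
  have h7 : 2 * (μ : ℝ) ≤ ε := by exact_mod_cast hμ
  have hε' : (0 : ℝ) < ε := by exact_mod_cast hε
  by_contra! hcon
  -- Prices are at least one, so a positive excess demand is at most the surplus.
  have h8 : (M.aggDemand p j - 1) ≤ M.surplus p j := by
    unfold surplus
    nlinarith [hp.1 j]
  linarith

theorem coe_updatePrices (p : Fin m → ℚ) (a b : ℕ) (G : Finset (Fin m)) :
    (fun k => ((updatePrices p ((a : ℚ) / b) G k : ℚ) : ℝ)) =
      scaled (fun k => (p k : ℝ)) ((a : ℝ) / b) G := by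
  ext k
  simp only [updatePrices, scaled]
  split_ifs <;> push_cast <;> rfl

/-- The potential of a price vector, relative to equilibrium prices `r`. -/
noncomputable def potential (M : ExchangeMarket n m) (r p : Fin m → ℝ) : ℝ :=
  Real.log (∑ j, max (M.surplus p j) 0 ^ 2) - 4 * ∑ j, Real.log (min (p j) (r j))

/-- The capped price of `i` grows by the full factor `x` and no other capped price falls. Four times
this log x cancels x⁴, and log(1 - κ) ≤ -κ remains. -/
theorem potential_scaled_le {p r : Fin m → ℝ} (hp : ∀ j, 1 ≤ p j) (hr : ∀ j, 1 ≤ r j) {x κ : ℝ}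
    (hx : 1 ≤ x) (hκ : κ < 1) {G : Finset (Fin m)} {i : Fin m} (hi : i ∈ G) (hir : x * p i ≤ r i)
    (h0 : 0 < ∑ j, max (M.surplus p j) 0 ^ 2)
    (h0' : 0 < ∑ j, max (M.surplus (scaled p x G) j) 0 ^ 2)
    (h : ∑ j, max (M.surplus (scaled p x G) j) 0 ^ 2 ≤
      (1 - κ) * x ^ 4 * ∑ j, max (M.surplus p j) 0 ^ 2) :
    potential M r (scaled p x G) ≤ potential M r p - κ := by
  have hx0 : 0 < x := by linarith
  have hL : ∑ j, Real.log (min (p j) (r j)) + Real.log x ≤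
      ∑ j, Real.log (min (scaled p x G j) (r j)) := by
    have hterm : ∀ j ∈ Finset.univ, Real.log (min (p j) (r j)) + (if j = i then Real.log x else 0) ≤
        Real.log (min (scaled p x G j) (r j)) := by
      intro j _
      have hpj : 0 < p j := by linarith [hp j]
      have hrj : 0 < r j := by linarith [hr j]
      split_ifs with hji
      · subst hji
        have hle : p j ≤ x * p j := by nlinarith
        rw [min_eq_left (hle.trans hir), scaled, if_pos hi, min_eq_left hir,
          Real.log_mul hx0.ne' hpj.ne', add_comm]
      · rw [add_zero]
        exact Real.log_le_log (lt_min hpj hrj)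
          (min_le_min_right _ (le_scaled (fun j => by linarith [hp j]) hx G j))
    have := Finset.sum_le_sum hterm
    rwa [Finset.sum_add_distrib, Finset.sum_ite_eq' Finset.univ i,
      if_pos (Finset.mem_univ i)] at this
  have h1 := Real.log_le_log h0' h
  rw [Real.log_mul (by have : 0 < (1 - κ) * x ^ 4 := mul_pos (by linarith) (by positivity)
                       exact this.ne') h0.ne',
    Real.log_mul (by linarith) (by positivity), Real.log_pow] at h1
  have h2 := Real.log_le_sub_one_of_pos (by linarith : 0 < 1 - κ)
  unfold potential
  push_cast at h1
  linarith

theorem le_potential {D₁ : ℕ} {p r : Fin m → ℝ} (hp : ∀ j, 1 ≤ p j)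
    (hr : ∀ j, 1 ≤ r j ∧ r j ≤ 2 ^ D₁) {E : ℝ} (hE : 0 < E) {k : Fin m}
    (hk : E ≤ M.surplus p k) :
    2 * Real.log E - 4 * (m * (D₁ * Real.log 2)) ≤ potential M r p := by
  have h1 : E ^ 2 ≤ ∑ j, max (M.surplus p j) 0 ^ 2 := by
    have h2 : max (M.surplus p k) 0 ^ 2 ≤ ∑ j, max (M.surplus p j) 0 ^ 2 :=
      Finset.single_le_sum (f := fun j => max (M.surplus p j) 0 ^ 2) (fun j _ => sq_nonneg _)
        (Finset.mem_univ k)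
    exact (pow_le_pow_left₀ hE.le (hk.trans (le_max_left _ _)) 2).trans h2
  have h3 := Real.log_le_log (by positivity) h1
  rw [Real.log_pow] at h3
  have h4 : ∑ j, Real.log (min (p j) (r j)) ≤ m * (D₁ * Real.log 2) := by
    refine (Finset.sum_le_sum (g := fun _ => (D₁ : ℝ) * Real.log 2) fun j _ => ?_).trans ?_
    · rw [← Real.log_pow]
      exact Real.log_le_log (lt_min (by linarith [hp j]) (by linarith [(hr j).1]))
        ((min_le_right _ _).trans (hr j).2)
    · simp
  unfold potential
  push_cast at h3
  linarith

/-- At prices one the capped logarithms vanish, and each of the m positive parts is at most m. If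
all surpluses are zero, the convention log 0 = 0 still fits. -/
theorem potential_one_le (hm : 1 ≤ m) (hU : M.UniqueDemands) {r : Fin m → ℝ}
    (hr : ∀ j, 1 ≤ r j) : potential M r (fun _ => 1) ≤ 3 * Real.log m := by
  have hm' : (1 : ℝ) ≤ m := by exact_mod_cast hm
  have h0 : ∑ j, Real.log (min 1 (r j)) = 0 := by
    refine Finset.sum_eq_zero fun j _ => ?_
    rw [min_eq_left (hr j), Real.log_one]
  have hadm := admissible_one (M := M)
  have h1 : ∑ j, max (M.surplus (fun _ => 1) j) 0 ^ 2 ≤ (m : ℝ) ^ 3 := by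
    refine (Finset.sum_le_sum (g := fun _ => (m : ℝ) ^ 2) fun j _ => ?_).trans (le_of_eq ?_)
    · refine pow_le_pow_left₀ (le_max_right _ _) (max_le ?_ (by linarith)) 2
      exact (le_abs_self _).trans ((abs_le_sum_posPart (sum_surplus hm hU hadm.pos) j).trans
        (hadm.sum_posPart_le hm hU))
    · simp; ring
  have h2 : 0 ≤ ∑ j, max (M.surplus (fun _ => 1) j) 0 ^ 2 :=
    Finset.sum_nonneg fun j _ => sq_nonneg _
  have h3 : Real.log (∑ j, max (M.surplus (fun _ => 1) j) 0 ^ 2) ≤ 3 * Real.log m := by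
    rcases h2.eq_or_lt with h | h
    · rw [← h, Real.log_zero]
      have := Real.log_nonneg hm'
      positivity
    · have := Real.log_le_log h h1
      rwa [Real.log_pow] at this
  unfold potential
  rw [h0]
  linarith

end Termination

/-! ### Parameters -/

section Parameters

variable {R₁ m D₁ D₂ : ℕ} {ε : ℚ}

theorem precision_pos (hR : 51200 ≤ R₁) (hm : 1 ≤ m) (hε : 0 < ε) : 0 < precision R₁ m ε := by
  unfold precision
  have : 0 < R₁ := by omega
  positivity

/-- Surpluses above ε/(4m²) must be large enough for `round_progress`; 51200 is 4 · 12800, and m⁵ of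
the available m⁷ suffices. -/
theorem precision_le (hR : 51200 ≤ R₁) (hm : 1 ≤ m) (hε : 0 < ε) :
    12800 * (m : ℝ) ^ 3 * precision R₁ m ε ≤ (ε : ℝ) / (4 * m ^ 2) := by
  have hε' : (0 : ℝ) < ε := by exact_mod_cast hε
  have hm' : (1 : ℝ) ≤ m := by exact_mod_cast hm
  have hR' : (51200 : ℝ) ≤ R₁ := by exact_mod_cast hR
  have hR0 : (0 : ℝ) < R₁ := by linarith
  unfold precision
  push_cast
  rw [mul_div_assoc', div_le_div_iff₀ (by positivity) (by positivity)]
  have h1 : (m : ℝ) ^ 5 ≤ m ^ 7 := pow_le_pow_right₀ hm' (by norm_num)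
  have h2 : 51200 * (m : ℝ) ^ 5 ≤ R₁ * m ^ 7 := by
    apply mul_le_mul hR' h1 (by positivity) (by positivity)
  have h3 : 12800 * (m : ℝ) ^ 3 * ε * (4 * m ^ 2) = ε * (51200 * m ^ 5) := by ring
  rw [h3]
  exact mul_le_mul_of_nonneg_left h2 hε'.le

theorem fracBound_eq (hR : 51200 ≤ R₁) (hm : 1 ≤ m) (hε : 0 < ε) :
    (precision R₁ m ε : ℝ) * fracBound R₁ m D₁ D₂ ε = m * 2 ^ (D₁ + D₂) := by
  have h := precision_pos hR hm hε
  have : precision R₁ m ε * fracBound R₁ m D₁ D₂ ε = m * 2 ^ (D₁ + D₂) := by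
    unfold fracBound
    rw [← mul_assoc, mul_one_div_cancel h.ne', one_mul, mul_comm]
  exact_mod_cast this

/-- The bound on ε makes Δ at least 12800 · 2^D₁, so rounding down loses at most a factor 2. -/
theorem lt_floor_fracBound (hR : 51200 ≤ R₁) (hm : 1 ≤ m) (hε : 0 < ε)
    (hεm : (ε : ℝ) < 4 * m ^ 3) :
    (2 : ℝ) ^ D₁ < ⌊fracBound R₁ m D₁ D₂ ε⌋₊ ∧
    m * 2 ^ (D₁ + D₂) ≤ 2 * (precision R₁ m ε : ℝ) * ⌊fracBound R₁ m D₁ D₂ ε⌋₊ := by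
  have hμ : (0 : ℝ) < precision R₁ m ε := by exact_mod_cast precision_pos hR hm hε
  have hm' : (1 : ℝ) ≤ m := by exact_mod_cast hm
  have hμ1 : (precision R₁ m ε : ℝ) * 12800 ≤ m := by
    have h1 := precision_le hR hm hε
    have h2 : (ε : ℝ) / (4 * m ^ 2) ≤ m := by
      rw [div_le_iff₀ (by positivity)]
      linarith [show (m : ℝ) * (4 * m ^ 2) = 4 * m ^ 3 by ring]
    have h3 : (1 : ℝ) ≤ (m : ℝ) ^ 3 := one_le_pow₀ hm'
    nlinarith
  have heq := fracBound_eq (D₁ := D₁) (D₂ := D₂) hR hm hε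
  set Δ : ℝ := ((fracBound R₁ m D₁ D₂ ε : ℚ) : ℝ) with hΔ
  have hfl : Δ < (⌊fracBound R₁ m D₁ D₂ ε⌋₊ : ℝ) + 1 := by
    have := Nat.lt_floor_add_one (fracBound R₁ m D₁ D₂ ε)
    have h2 : ((fracBound R₁ m D₁ D₂ ε : ℚ) : ℝ) <
        (((⌊fracBound R₁ m D₁ D₂ ε⌋₊ : ℚ) + 1 : ℚ) : ℝ) := by exact_mod_cast this
    push_cast at h2
    exact h2
  have hpow : (2 : ℝ) ^ D₁ ≤ 2 ^ (D₁ + D₂) := pow_le_pow_right₀ (by norm_num) (by omega)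
  have hpow1 : (1 : ℝ) ≤ 2 ^ D₁ := one_le_pow₀ (by norm_num)
  have hbig : 12800 * (2 : ℝ) ^ D₁ ≤ Δ := by
    have h1 : (precision R₁ m ε : ℝ) * (12800 * 2 ^ D₁) ≤ precision R₁ m ε * Δ := by
      rw [heq, ← mul_assoc]
      exact mul_le_mul hμ1 hpow (by positivity) (by linarith)
    exact le_of_mul_le_mul_left h1 hμ
  constructor
  · linarith
  · rw [← heq]
    have : Δ ≤ 2 * (⌊fracBound R₁ m D₁ D₂ ε⌋₊ : ℝ) := by linarith
    nlinarith

theorem one_le_logInv (ε : ℚ) : 1 ≤ logInv ε := le_max_left _ _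

theorem logb_floor_fracBound_le (hR : 51200 ≤ R₁) (hm : 1 ≤ m) (hε : 0 < ε) :
    Real.logb 2 (max ⌊fracBound R₁ m D₁ D₂ ε⌋₊ 1 : ℕ) ≤
      2 * (Real.log R₁ + 8) * (D₁ + D₂ + Real.log m + logInv ε) := by
  have hε' : (0 : ℝ) < ε := by exact_mod_cast hε
  have hm' : (1 : ℝ) ≤ m := by exact_mod_cast hm
  have hR1 : (1 : ℝ) ≤ R₁ := by exact_mod_cast (by omega : 1 ≤ R₁)
  have hlm := Real.log_nonneg hm'
  have hlR := Real.log_nonneg hR1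
  have hl := one_le_logInv ε
  have hl2 : Real.log (1 / (ε : ℝ)) ≤ logInv ε := le_max_right _ _
  have hD : (0 : ℝ) ≤ (D₁ : ℝ) + D₂ := by positivity
  set Y := (D₁ : ℝ) + D₂ + Real.log m + logInv ε with hY
  have hY1 : 1 ≤ Y := by linarith
  have hlog2 : 1 / 2 ≤ Real.log 2 := by linarith [Real.log_two_gt_d9]
  have hlog2' : Real.log 2 ≤ 1 := by linarith [Real.log_two_lt_d9]
  have hΔ : ((fracBound R₁ m D₁ D₂ ε : ℚ) : ℝ) = R₁ * m ^ 8 * 2 ^ (D₁ + D₂) * (1 / ε) := by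
    unfold fracBound precision
    push_cast
    field_simp
  have hΔlog : Real.log (fracBound R₁ m D₁ D₂ ε : ℚ) ≤ (Real.log R₁ + 8) * Y := by
    rw [hΔ, Real.log_mul (by positivity) (by positivity), Real.log_mul (by positivity)
      (by positivity), Real.log_mul (by positivity) (by positivity), Real.log_pow, Real.log_pow]
    push_cast
    have h1 : ((D₁ : ℝ) + D₂) * Real.log 2 ≤ D₁ + D₂ := mul_le_of_le_one_right hD hlog2'
    nlinarith [mul_nonneg hlR (sub_nonneg.2 hY1)]
  have hrhs : 0 ≤ (Real.log R₁ + 8) * Y := by positivity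
  have hlog : Real.log (max ⌊fracBound R₁ m D₁ D₂ ε⌋₊ 1 : ℕ) ≤ (Real.log R₁ + 8) * Y := by
    rcases le_total ⌊fracBound R₁ m D₁ D₂ ε⌋₊ 1 with h | h
    · rw [max_eq_right h, Nat.cast_one, Real.log_one]
      exact hrhs
    · rw [max_eq_left h]
      refine le_trans (Real.log_le_log (by exact_mod_cast h) ?_) hΔlog
      have h0 : 0 ≤ fracBound R₁ m D₁ D₂ ε := by
        unfold fracBound precision
        positivity
      have := Nat.floor_le h0
      exact_mod_cast this
  rw [Real.logb, div_le_iff₀ (by linarith)]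
  nlinarith

end Parameters

end WGS

namespace WGS

open OracleProg ExchangeMarket

/-! ### The algorithm -/

section Algorithm

variable {n m : ℕ} {M : ExchangeMarket n m}

/-- A round either reaches the stopping criterion, or starts from a large surplus and decreases
the potential. -/
theorem round_step (hm : 1 ≤ m) (hU : M.UniqueDemands) (hG : M.WeakGrossSubstitutes)
    {R₁ D₁ D₂ : ℕ} (hD : M.BoundedDerivatives D₁ D₂) {r : Fin m → ℝ}
    (hr : ∀ j, 1 ≤ r j ∧ r j ≤ 2 ^ D₁) (hr1 : ∀ j, M.aggDemand r j = 1) {ε : ℚ} (hε : 0 < ε)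
    {O : (Fin m → ℚ) × ℚ → (Fin m → ℚ)} (hO : M.IsApproxOracle O) (hR : 51200 ≤ R₁)
    {μ : ℚ} (hμ : μ = precision R₁ m ε) {N : ℕ} (hN : N = ⌊fracBound R₁ m D₁ D₂ ε⌋₊)
    {p p' : Fin m → ℚ} (hp : M.Admissible (fun j => (p j : ℝ))) {K : ℕ}
    (hK : ∀ j, IsQuotLE K (p j)) (hp' : p' = (round μ N p).result O) :
    M.Admissible (fun j => (p' j : ℝ)) ∧ (∃ K', ∀ j, IsQuotLE K' (p' j)) ∧
    (∑ i, O (p', μ) i ^ 2 < ε ^ 2 / (4 * m) ∨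
      ((∃ k, (ε : ℝ) / (4 * m ^ 2) < M.surplus (fun j => (p j : ℝ)) k) ∧
        potential M r (fun j => (p' j : ℝ)) ≤
          potential M r (fun j => (p j : ℝ)) - 1 / (800 * (m : ℝ) ^ 3) ∧
        2 * Real.log ((ε : ℝ) / (4 * m ^ 2)) - 4 * (m * (D₁ * Real.log 2)) ≤
          potential M r (fun j => (p' j : ℝ)))) := by
  have hm' : (1 : ℝ) ≤ m := by exact_mod_cast hm
  have hm3 : (1 : ℝ) ≤ (m : ℝ) ^ 3 := one_le_pow₀ hm'
  have hε' : (0 : ℝ) < ε := by exact_mod_cast hε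
  have hμ0 : 0 < μ := hμ ▸ precision_pos hR hm hε
  have hμ0' : (0 : ℝ) < μ := by exact_mod_cast hμ0
  have hμE : 12800 * (m : ℝ) ^ 3 * μ ≤ (ε : ℝ) / (4 * m ^ 2) := hμ ▸ precision_le hR hm hε
  set E : ℝ := (ε : ℝ) / (4 * m ^ 2) with hE
  have hE0 : 0 < E := by positivity
  have hμE' : 12800 * (μ : ℝ) ≤ E := by nlinarith
  have hmE : m * E = ε / (4 * m) := by rw [hE]; field_simp
  have hμε : (μ : ℝ) < ε / (4 * m) := by rw [← hmE]; nlinarith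
  have hpos : ∀ j, 0 < p j := fun j => (hK j).pos
  obtain ⟨⟨a, b, c, d, hB, hac, hres⟩, -⟩ := round_spec O μ N p hK
  set s₀ := O (p, μ) with hs₀
  set G := topGoods s₀ μ with hGdef
  set P : Fin m → ℝ := fun j => (p j : ℝ) with hP
  set x : ℝ := (a : ℝ) / b with hx
  have hx1 : 1 ≤ x := hB.one_le_div
  have happ : Approximates s₀ (M.surplus P) μ := fun j => hO p μ hpos hμ0 j
  have hupd : ∀ a b : ℕ, 1 ≤ b → b ≤ a → Approximates (O (updatePrices p ((a : ℚ) / b) G, μ))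
      (M.surplus (scaled P ((a : ℝ) / b) G)) μ := fun a b hb hba j => by
    rw [hP, ← coe_updatePrices]
    refine hO _ μ (fun j => ?_) hμ0 j
    exact (isQuotLE_updatePrices (N := a) hK hb hba (le_max_left _ _) G j).pos
  rw [hres] at hp'
  subst hp'
  rw [coe_updatePrices, ← hP, ← hx]
  have happ' := hupd a b hB.one_le_b hB.b_le_a
  rw [← hx] at happ'
  have hcase : x = 1 ∨ ∀ i ∈ G, 0 ≤ M.surplus (scaled P x G) i := by
    rcases hB.lower with ⟨h1, h2⟩ | h
    · left; rw [hx, h1, h2]; norm_num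
    · exact Or.inr fun i hi => nonneg_of_searchCond happ' h hi
  have hadm : M.Admissible (scaled P x G) := by
    rcases hcase with h | h
    · rwa [h, scaled_one]
    · exact hp.scaled hG hx1 h
  have hl1 : ∑ j, max (M.surplus (scaled P x G) j) 0 ≤ ∑ j, max (M.surplus P j) 0 := by
    rcases hcase with h | h
    · rw [h, scaled_one]
    · exact sum_posPart_scaled_le hm hU hG hp.pos hx1 h
  refine ⟨hadm, ⟨_, isQuotLE_updatePrices hK hB.one_le_b hB.b_le_a hB.a_le G⟩, ?_⟩
  rw [or_iff_not_imp_left]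
  intro hfin
  have hsmall : ∀ {s : Fin m → ℝ}, (∀ j, s j ≤ E) → ∑ j, max (s j) 0 ≤ ε / (4 * m) := fun h => by
    refine (Finset.sum_le_sum fun j _ => max_le (h j) hE0.le).trans (le_of_eq ?_)
    rw [← hmE]
    simp
  have hlarge : ¬ ∑ j, max (M.surplus (scaled P x G) j) 0 ≤ ε / (4 * m) := fun h =>
    hfin (sum_sq_lt_of_sum_posPart_le hm happ' (sum_surplus hm hU hadm.pos) h hμε)
  -- The total of the positive parts does not grow in a round, so a large total afterwards forces a
  -- large surplus before.
  obtain ⟨k, hk⟩ : ∃ k, E < M.surplus P k := by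
    by_contra! hcon
    exact hlarge (hl1.trans (hsmall hcon))
  obtain ⟨k', hk'⟩ : ∃ k, E < M.surplus (scaled P x G) k := by
    by_contra! hcon
    exact hlarge (hsmall hcon)
  -- No surplus exceeds m at admissible prices, so for larger ε the round would have met the
  -- stopping criterion.
  have hεm : (ε : ℝ) < 4 * m ^ 3 := by
    have h1 : E < m := hk.trans_le ((le_abs_self _).trans
      ((abs_le_sum_posPart (sum_surplus hm hU hp.pos) k).trans (hp.sum_posPart_le hm hU)))
    rw [hE, div_lt_iff₀ (by positivity)] at h1
    linarith [show (m : ℝ) * (4 * m ^ 2) = 4 * m ^ 3 by ring]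
  obtain ⟨hN1, hN2⟩ := lt_floor_fracBound (D₁ := D₁) (D₂ := D₂) hR hm hε hεm
  rw [← hN] at hN1 hN2
  rw [← hμ] at hN2
  obtain ⟨hdec, i, hi, hir⟩ := round_progress hm hU hG hD hp hr hr1 hμ0 hN1 hN2 happ hupd hB hac
    (k := k) (k' := k') (hμE.trans hk.le) (by linarith)
  have hsq : ∀ {s : Fin m → ℝ} {k : Fin m}, E < s k → 0 < ∑ j, max (s j) 0 ^ 2 := fun {s k} h =>
    Finset.sum_pos' (fun j _ => sq_nonneg _)
      ⟨k, Finset.mem_univ k, pow_pos (lt_max_of_lt_left (hE0.trans h)) 2⟩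
  refine ⟨⟨k, hk⟩, ?_, le_potential hadm.1 hr hE0 hk'.le⟩
  refine potential_scaled_le hp.1 (fun j => (hr j).1) hx1 ?_ hi hir (hsq hk) (hsq hk') hdec
  rw [div_lt_one (by positivity)]
  linarith

theorem logInv_le_roundBound (hm : 1 ≤ m) (D₁ : ℕ) (ε : ℚ) :
    (m : ℝ) ^ 3 * logInv ε ≤ roundBound m D₁ ε := by
  have hlm : 0 ≤ Real.log m := Real.log_nonneg (by exact_mod_cast hm)
  unfold roundBound
  have : 0 ≤ (D₁ : ℝ) * (m : ℝ) ^ 7 * Real.log m := by positivity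
  linarith

theorem one_le_roundBound (hm : 1 ≤ m) (D₁ : ℕ) (ε : ℚ) : 1 ≤ roundBound m D₁ ε := by
  have hm3 : (1 : ℝ) ≤ (m : ℝ) ^ 3 := one_le_pow₀ (by exact_mod_cast hm)
  have := one_le_logInv ε
  exact (by nlinarith : 1 ≤ (m : ℝ) ^ 3 * logInv ε).trans (logInv_le_roundBound hm D₁ ε)

/-- The number of rounds that the potential allows for. -/
theorem roundCount_le (hm : 2 ≤ m) {D₁ : ℕ} (hD₁ : 1 ≤ D₁) {ε : ℚ} (hε : 0 < ε) {X : ℝ}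
    (hX : X = 3 * Real.log m -
      (2 * Real.log ((ε : ℝ) / (4 * m ^ 2)) - 4 * (m * (D₁ * Real.log 2)))) :
    800 * (m : ℝ) ^ 3 * X + 1 ≤ 8801 * roundBound m D₁ ε := by
  have hm' : (2 : ℝ) ≤ m := by exact_mod_cast hm
  have hm0 : (0 : ℝ) < m := by linarith
  have hε' : (0 : ℝ) < ε := by exact_mod_cast hε
  have hD' : (1 : ℝ) ≤ D₁ := by exact_mod_cast hD₁
  have hl := one_le_logInv ε
  have hl2 : Real.log (1 / (ε : ℝ)) ≤ logInv ε := le_max_right _ _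
  have hlog2 : 0 < Real.log 2 := Real.log_pos (by norm_num)
  have hlog2' : Real.log 2 ≤ 3 / 4 := by linarith [Real.log_two_lt_d9]
  have hlm : Real.log 2 ≤ Real.log m := Real.log_le_log (by norm_num) hm'
  have hlogE : Real.log ((ε : ℝ) / (4 * m ^ 2)) =
      -Real.log (1 / (ε : ℝ)) - 2 * Real.log 2 - 2 * Real.log m := by
    have h4 : (4 : ℝ) = 2 ^ 2 := by norm_num
    rw [Real.log_div hε'.ne' (by positivity), Real.log_mul (by norm_num) (by positivity),
      Real.log_pow, h4, Real.log_pow, one_div, Real.log_inv]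
    push_cast
    ring
  -- The term 4 log 2 ≤ 3 is absorbed by `logInv ε ≥ 1`, which turns the coefficient 2 into 5.
  have hX' : X ≤ 7 * Real.log m + 5 * logInv ε + 4 * (m * (D₁ * Real.log 2)) := by
    rw [hX, hlogE]
    linarith
  have hm3 : (1 : ℝ) ≤ (m : ℝ) ^ 3 := one_le_pow₀ (by linarith)
  have hpow : (m : ℝ) ^ 4 ≤ m ^ 7 := pow_le_pow_right₀ (by linarith) (by norm_num)
  have hpow' : (m : ℝ) ^ 3 ≤ m ^ 7 := pow_le_pow_right₀ (by linarith) (by norm_num)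
  have h1 : (m : ℝ) ^ 3 * Real.log m ≤ D₁ * m ^ 7 * Real.log m := by
    refine mul_le_mul_of_nonneg_right ?_ (by linarith)
    nlinarith [pow_pos hm0 7]
  have h2 : (m : ℝ) ^ 3 * (m * (D₁ * Real.log 2)) ≤ D₁ * m ^ 7 * Real.log m := by
    have e : (m : ℝ) ^ 3 * (m * (D₁ * Real.log 2)) = D₁ * m ^ 4 * Real.log 2 := by ring
    rw [e]
    exact mul_le_mul (mul_le_mul_of_nonneg_left hpow (by linarith)) hlm hlog2.le (by positivity)
  have h3 : 1 ≤ (m : ℝ) ^ 3 * logInv ε := by nlinarith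
  have h4 := mul_le_mul_of_nonneg_left hX' (by positivity : 0 ≤ (m : ℝ) ^ 3)
  have h5 : (0 : ℝ) ≤ D₁ * m ^ 7 * Real.log m := le_trans (by positivity) h2
  unfold roundBound
  nlinarith

/-- The algorithm stops, with an approximate equilibrium, within the claimed number of rounds. -/
theorem exists_result_algWGS (hm : 1 ≤ m) (hU : M.UniqueDemands) (hG : M.WeakGrossSubstitutes)
    {R₁ D₁ D₂ : ℕ} (hB : M.BoundedPrice D₁) (hD : M.BoundedDerivatives D₁ D₂) {ε : ℚ} (hε : 0 < ε)
    {O : (Fin m → ℚ) × ℚ → (Fin m → ℚ)} (hO : M.IsApproxOracle O) (hR : 51200 ≤ R₁) :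
    ∃ (T : ℕ) (p : Fin m → ℚ), (T : ℝ) ≤ 8801 * roundBound m D₁ ε ∧
      (algWGS R₁ m D₁ D₂ ε T).result O = some p ∧
      ∃ x, M.IsApproxEquilibrium (1 + (ε : ℝ)) x (fun j => (p j : ℝ)) := by
  obtain ⟨y, r, he, hr⟩ := hB
  have hm' : (1 : ℝ) ≤ m := by exact_mod_cast hm
  have hr0 : ∀ j, 0 < r j := fun j => zero_lt_one.trans_le (hr j).1
  have hr1 := aggDemand_eq_one_of_isEquilibrium hU hr0 he
  have hε' : (0 : ℝ) < ε := by exact_mod_cast hε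
  set μ := precision R₁ m ε with hμ
  set N := ⌊fracBound R₁ m D₁ D₂ ε⌋₊ with hN
  set p₀ : Fin m → ℚ := fun _ => 1 with hp₀
  have hcast : (fun j => ((p₀ j : ℚ) : ℝ)) = fun _ => 1 := by simp [hp₀]
  have hμ0 : 0 < μ := precision_pos hR hm hε
  have hadm₀ : M.Admissible (fun j => (p₀ j : ℝ)) := by rw [hcast]; exact admissible_one
  have hquot₀ : ∀ j, IsQuotLE 1 (p₀ j) := fun j =>
    ⟨1, 1, le_rfl, le_rfl, le_rfl, le_rfl, by simp [hp₀]⟩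
  have hkey : ∃ (T : ℕ) (p : Fin m → ℚ), (T : ℝ) ≤ 8801 * roundBound m D₁ ε ∧
      (roundsUntil μ N (ε ^ 2 / (4 * m)) T p₀).result O = some p ∧
      (M.Admissible (fun j => (p j : ℝ)) ∧ ∃ K, ∀ j, IsQuotLE K (p j)) ∧
      ∑ i, O (p, μ) i ^ 2 < ε ^ 2 / (4 * m) := by
    -- With small initial surpluses one round is enough. This covers D₁ = 0, where the initial
    -- prices are equilibrium prices, and m = 1, where Walras' law makes the surplus zero. Otherwise
    -- D₁ log m > 0, so that D₁ m⁷ log m can absorb the terms in log m and m D₁.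
    by_cases hdeg : ∀ j, M.surplus (fun j => (p₀ j : ℝ)) j ≤ (ε : ℝ) / (4 * m ^ 2)
    · obtain ⟨h1, h2, h3⟩ := round_step hm hU hG hD hr hr1 hε hO hR hμ hN hadm₀ hquot₀ rfl
      have hfin := h3.resolve_right fun ⟨⟨k, hk⟩, _⟩ => absurd hk (not_lt.2 (hdeg k))
      refine ⟨1, (round μ N p₀).result O, ?_, ?_, ⟨h1, h2⟩, hfin⟩
      · have := one_le_roundBound hm D₁ ε
        push_cast
        linarith
      · have hres : (roundsUntil μ N (ε ^ 2 / (4 * m)) 1 p₀).result O =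
            (if ∑ i, O ((round μ N p₀).result O, μ) i ^ 2 < ε ^ 2 / (4 * m) then
              pure (some ((round μ N p₀).result O))
              else roundsUntil μ N (ε ^ 2 / (4 * m)) 0 ((round μ N p₀).result O) :
                MarketProg m (Option (Fin m → ℚ))).result O := by
          rw [roundsUntil_succ]
          simp only [result_bind]
          rfl
        rw [hres, if_pos hfin]
        rfl
    · have hE0 : 0 < (ε : ℝ) / (4 * m ^ 2) := by positivity
      have hD₁ : 1 ≤ D₁ := by
        by_contra! h0
        refine hdeg fun j => ?_
        have hr' : r = fun _ => 1 := by
          ext j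
          have := hr j
          rw [Nat.lt_one_iff.1 h0, pow_zero] at this
          exact le_antisymm this.2 this.1
        rw [hcast, ← hr', surplus, hr1]
        simpa using hE0.le
      have hm2 : 2 ≤ m := by
        by_contra! h0
        obtain rfl : m = 1 := by omega
        refine hdeg fun j => ?_
        have hsum := sum_surplus hm hU hadm₀.pos
        rw [Fin.sum_univ_one] at hsum
        rw [Subsingleton.elim j 0, hsum]
        exact hE0.le
      set F₀ := 2 * Real.log ((ε : ℝ) / (4 * m ^ 2)) - 4 * (m * (D₁ * Real.log 2)) with hF₀
      -- The added one makes the inequality in the round count strict and ensures at least one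
      -- round.
      set T := ⌊800 * (m : ℝ) ^ 3 * (3 * Real.log m - F₀)⌋₊ + 1 with hT
      have hlt : 800 * (m : ℝ) ^ 3 * (3 * Real.log m - F₀) < T := by
        rw [hT]; push_cast; exact Nat.lt_floor_add_one _
      have hκ : 0 < 1 / (800 * (m : ℝ) ^ 3) := by positivity
      obtain ⟨p, h1, h2, h3⟩ := exists_roundsUntil_eq_some (O := O) (μ := μ) (N := N)
        (δ := ε ^ 2 / (4 * m))
        (P := fun p => M.Admissible (fun j => (p j : ℝ)) ∧ ∃ K, ∀ j, IsQuotLE K (p j))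
        (F := fun p => potential M r (fun j => (p j : ℝ))) (F₀ := F₀) hκ
        (fun p ⟨hp, K, hK⟩ => by
          obtain ⟨h1, h2, h3⟩ := round_step hm hU hG hD hr hr1 hε hO hR hμ hN hp hK rfl
          exact ⟨⟨h1, h2⟩, h3.imp_right fun h => h.2⟩)
        T p₀ ⟨hadm₀, 1, hquot₀⟩ (by omega) (by
          have h1 := potential_one_le (M := M) hm hU fun j => (hr j).1
          rw [hcast, one_div, inv_mul_eq_div, lt_div_iff₀ (by positivity)]
          refine lt_of_le_of_lt ?_ hlt
          rw [mul_comm]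
          exact mul_le_mul_of_nonneg_left (by linarith) (by positivity))
      refine ⟨T, p, ?_, h1, h2, h3⟩
      have hcount := roundCount_le hm2 hD₁ hε (X := 3 * Real.log m - F₀) rfl
      rcases le_total 0 (800 * (m : ℝ) ^ 3 * (3 * Real.log m - F₀)) with h | h
      · have := Nat.floor_le h
        rw [hT]
        push_cast
        linarith
      · rw [hT, Nat.floor_of_nonpos h]
        have := one_le_roundBound hm D₁ ε
        push_cast
        linarith
  obtain ⟨T, p, h1, h2, ⟨h3, K, hK⟩, h4⟩ := hkey
  refine ⟨T, p, h1, ?_, ?_⟩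
  · simp only [algWGS, result_bind]
    exact h2
  · refine exists_isApproxEquilibrium hm hU h3 hε (fun j => hO p μ (fun j => (hK j).pos) hμ0 j) ?_ h4
    have h5 := precision_le hR hm hε
    have hm3 : (1 : ℝ) ≤ (m : ℝ) ^ 3 := one_le_pow₀ hm'
    have h6 : (ε : ℝ) / (4 * m ^ 2) ≤ ε :=
      div_le_self hε'.le (by nlinarith [one_le_pow₀ hm' (n := 2)])
    have hμ0' : (0 : ℝ) < μ := by exact_mod_cast hμ0
    have h7 : 2 * (μ : ℝ) ≤ ε := by nlinarith
    exact_mod_cast h7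

/-- Cost of the algorithm when it is cut off after `T` rounds. -/
theorem cost_algWGS (hm : 1 ≤ m) {R₁ D₁ D₂ T : ℕ} {ε : ℚ} (hε : 0 < ε) (hR : 51200 ≤ R₁)
    (O : (Fin m → ℚ) × ℚ → (Fin m → ℚ)) (hT : (T : ℝ) ≤ 8801 * roundBound m D₁ ε) {C : ℝ}
    (hC : C = 8801 * (600 * (Real.log R₁ + 8) + 200)) :
    (((algWGS R₁ m D₁ D₂ ε T).queries O).length : ℝ) ≤ C * queryBound m D₁ D₂ ε ∧
    ((algWGS R₁ m D₁ D₂ ε T).time O : ℝ) ≤ C * (m : ℝ) ^ 2 * queryBound m D₁ D₂ ε ∧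
    ∀ q ∈ (algWGS R₁ m D₁ D₂ ε T).queries O, ∀ j, 0 < q.1 j ∧
      ((q.1 j).num.natAbs.size : ℝ) ≤ C * queryBound m D₁ D₂ ε ∧
      ((q.1 j).den.size : ℝ) ≤ C * queryBound m D₁ D₂ ε := by
  have hm' : (1 : ℝ) ≤ m := by exact_mod_cast hm
  have hm2 : (m : ℝ) ≤ (m : ℝ) ^ 2 := by nlinarith
  have hlm : 0 ≤ Real.log m := Real.log_nonneg hm'
  have hlR : 0 ≤ Real.log R₁ := Real.log_nonneg (by exact_mod_cast (by omega : 1 ≤ R₁))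
  have hl := one_le_logInv ε
  have hRB := one_le_roundBound hm D₁ ε
  have hΛ := logb_floor_fracBound_le (D₁ := D₁) (D₂ := D₂) hR hm hε
  set N := ⌊fracBound R₁ m D₁ D₂ ε⌋₊ with hN
  set Y := (D₁ : ℝ) + D₂ + Real.log m + logInv ε with hY
  set Λ := Real.logb 2 ((max N 1 : ℕ) : ℝ) with hΛdef
  have hDY : (D₁ : ℝ) + D₂ ≤ Y := by linarith
  have hY1 : 1 ≤ Y := by
    have : (0 : ℝ) ≤ (D₁ : ℝ) + D₂ := by positivity
    linarith
  have hΛ0 : 0 ≤ Λ := Real.logb_nonneg (by norm_num) (by exact_mod_cast le_max_right N 1)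
  set c₁ := Real.log R₁ + 8 with hc₁
  have hc₁8 : 8 ≤ c₁ := by linarith
  have hQB : queryBound m D₁ D₂ ε = roundBound m D₁ ε * Y := rfl
  set B := roundBound m D₁ ε with hBdef
  have hYB : Y ≤ B * Y := by nlinarith
  have hTY : T * Y ≤ 8801 * (B * Y) := by nlinarith
  have hTY0 : 0 ≤ T * Y := by positivity
  have hTΛ : T * Λ ≤ T * Y * (2 * c₁) := by
    have := mul_le_mul_of_nonneg_left hΛ (by positivity : (0 : ℝ) ≤ T)
    linarith
  have hTT : (T : ℝ) ≤ T * Y := le_mul_of_one_le_right (by positivity) hY1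
  have hcTY : T * Y * c₁ ≤ 8801 * (B * Y) * c₁ := mul_le_mul_of_nonneg_right hTY (by linarith)
  have hBY0 : 0 ≤ B * Y := by positivity
  have hcBY : 0 ≤ B * Y * c₁ := by positivity
  obtain ⟨h1, h2, h3⟩ := roundsUntil_cost O (precision R₁ m ε) N (ε ^ 2 / (4 * m)) T (fun _ => 1) 0
    (fun j => ⟨1, 1, le_rfl, by simp, le_rfl, by simp, by simp⟩)
  rw [← hΛdef] at h2 h3
  have hqueries : (algWGS R₁ m D₁ D₂ ε T).queries O =
      (roundsUntil (precision R₁ m ε) N (ε ^ 2 / (4 * m)) T (fun _ => 1)).queries O := by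
    simp only [algWGS, queries_bind, queries_pay, List.nil_append, hN]
  have htime : (algWGS R₁ m D₁ D₂ ε T).time O = (D₁ + D₂ + m + 20) +
      (roundsUntil (precision R₁ m ε) N (ε ^ 2 / (4 * m)) T (fun _ => 1)).time O := by
    simp only [algWGS, time_bind, time_pay, hN]
  rw [hQB, hC]
  refine ⟨?_, ?_, ?_⟩
  · rw [hqueries]
    refine h2.trans ?_
    linarith
  · rw [htime]
    push_cast
    have e1 : (3 * (m : ℝ) + 16) * (15 * Λ + 5) + m ^ 2 + 7 * m + 4 ≤
        m ^ 2 * (19 * (15 * Λ + 5) + 12) := by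
      have : (3 * (m : ℝ) + 16) * (15 * Λ + 5) ≤ (19 * m ^ 2) * (15 * Λ + 5) :=
        mul_le_mul_of_nonneg_right (by linarith) (by linarith)
      linarith
    have e2 : (T : ℝ) * ((3 * (m : ℝ) + 16) * (15 * Λ + 5) + m ^ 2 + 7 * m + 4) ≤
        m ^ 2 * (T * (19 * (15 * Λ + 5) + 12)) := by
      refine (mul_le_mul_of_nonneg_left e1 (by positivity)).trans (le_of_eq ?_)
      ring
    have e3 : (D₁ : ℝ) + D₂ + m + 20 ≤ m ^ 2 * (22 * (B * Y)) := by
      have : (D₁ : ℝ) + D₂ + m + 20 ≤ m ^ 2 * (22 * Y) := by nlinarith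
      exact this.trans (mul_le_mul_of_nonneg_left (by linarith) (by positivity))
    have e4 : T * (19 * (15 * Λ + 5) + 12) + 22 * (B * Y) ≤
        8801 * (600 * c₁ + 200) * (B * Y) := by linarith
    have e5 := mul_le_mul_of_nonneg_left e4 (by positivity : (0 : ℝ) ≤ (m : ℝ) ^ 2)
    have e6 : 8801 * (600 * c₁ + 200) * (m : ℝ) ^ 2 * (B * Y) =
      m ^ 2 * (8801 * (600 * c₁ + 200) * (B * Y)) := by ring
    rw [e6]
    linarith
  · rw [hqueries]
    intro q hq j
    have hquot := h1 q hq j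
    rw [zero_add] at hquot
    have hfinal : T * Λ + 1 ≤ 8801 * (600 * c₁ + 200) * (B * Y) := by linarith
    exact ⟨hquot.pos, (size_le_logb (le_max_right _ _) hquot.num_le).trans hfinal,
      (size_le_logb (le_max_right _ _) hquot.den_le).trans hfinal⟩

end Algorithm

end WGS

theorem mainTheorem1 :
    ∃ R₀ : ℕ, ∀ R₁ : ℕ, R₀ ≤ R₁ → ∃ C : ℝ,
      ∀ (n m : ℕ) (M : WGS.ExchangeMarket n m) (D₁ D₂ : ℕ) (ε : ℚ)
        (O : (Fin m → ℚ) × ℚ → (Fin m → ℚ)),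
        1 ≤ m → M.UniqueDemands → M.WeakGrossSubstitutes →
        M.BoundedPrice D₁ → M.BoundedDerivatives D₁ D₂ →
        0 < ε → M.IsApproxOracle O →
        ∃ (T : ℕ) (p : Fin m → ℚ),
          -- after `T` rounds the algorithm has returned the price vector `p`
          (T : ℝ) ≤ C * WGS.roundBound m D₁ ε ∧
          (WGS.algWGS R₁ m D₁ D₂ ε T).result O = some p ∧
          (∃ x, M.IsApproxEquilibrium (1 + (ε : ℝ)) x (fun j => (p j : ℝ))) ∧
          -- number of oracle queries
          (((WGS.algWGS R₁ m D₁ D₂ ε T).queries O).length : ℝ) ≤ C * WGS.queryBound m D₁ D₂ ε ∧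
          -- running time
          ((WGS.algWGS R₁ m D₁ D₂ ε T).time O : ℝ) ≤
            C * (m : ℝ) ^ 2 * WGS.queryBound m D₁ D₂ ε ∧
          -- bit lengths of the prices that occur
          (∀ q ∈ (WGS.algWGS R₁ m D₁ D₂ ε T).queries O, ∀ j, 0 < q.1 j ∧
            ((q.1 j).num.natAbs.size : ℝ) ≤ C * WGS.queryBound m D₁ D₂ ε ∧
            ((q.1 j).den.size : ℝ) ≤ C * WGS.queryBound m D₁ D₂ ε) := by
  refine ⟨51200, fun R₁ hR => ⟨8801 * (600 * (Real.log R₁ + 8) + 200), ?_⟩⟩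
  intro n m M D₁ D₂ ε O hm hU hG hB hD hε hO
  obtain ⟨T, p, hT, hres, hx⟩ := WGS.exists_result_algWGS hm hU hG hB hD hε hO hR
  obtain ⟨hq, ht, hsize⟩ := WGS.cost_algWGS (D₂ := D₂) hm hε hR O hT rfl
  refine ⟨T, p, hT.trans ?_, hres, hx, hq, ht, hsize⟩
  have hlR : 0 ≤ Real.log R₁ := Real.log_nonneg (by exact_mod_cast (by omega : 1 ≤ R₁))
  have h1 := WGS.one_le_roundBound hm D₁ ε
  exact mul_le_mul_of_nonneg_right (by linarith) (by linarith)
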